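/- Conventions. Let $\mathbb{H}^n$ be hyperbolic $n$-space with metric $\rho$. A convex polytope in $\mathbb{H}^n$ (or in a hyperbolic plane of $\mathbb{H}^n$ of smaller dimension) is an intersection of finitely many closed half-spaces with non-empty interior. It is a Coxeter polytope if the bounding hyperplanes of any two distinct facets either do not intersect or form a dihedral angle $\pi/k$ with an integer $k\ge 2$. Let $P\subset\mathbb{H}^n$ be a compact Coxeter polytope and $E$ an edge of $P$. The ridge of $P$ associated with $E$ is the collection of facets $F_1,\dots,F_{n+1}$, where $F_1,\dots,F_{n-1}$ are the facets of $P$ containing $E$, and $F_n,F_{n+1}$ are the framing facets of $E$, that is, the facets of $P$ that contain a vertex of $E$ but not $E$ itself. The width of this ridge is $\cosh\rho(F_n,F_{n+1})$, where $\rho(F_n,F_{n+1})$ is the distance between the sets $F_n$ and $F_{n+1}$. Statement. Let $n\ge 4$, let $P\subset\mathbb{H}^n$ be a compact Coxeter polytope, and let $P'$ be a $3$-dimensional face of $P$ that is itself a Coxeter polytope in the $3$-dimensional hyperbolic plane spanned by $P'$. Then there is an edge $E$ of $P$ such that exactly $n-1$ facets of $P$ contain $E$, exactly two facets of $P$ are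 framing facets of $E$, and the ridge of $P$ associated with $E$ has width less than $5.75$. -/

import Mathlib

/-!  Convex polytopes, Coxeter polytopes and ridges in hyperbolic space (vector model).  -/

namespace HypGeom

/-- The underlying vector space of the Minkowski space `ℝ^{n,1}`. -/
abbrev Minkowski (n : ℕ) : Type := Fin (n + 1) → ℝ

/-- The Minkowski inner product `(x, y) = - x₀ y₀ + x₁ y₁ + ⋯ + xₙ yₙ`. -/
def form {n : ℕ} (x y : Minkowski n) : ℝ :=
  -(x 0 * y 0) + ∑ i : Fin n, x i.succ * y i.succ

/-- Hyperbolic `n`-space: the upper sheet of the hyperboloid `(x, x) = -1`. -/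
def space (n : ℕ) : Set (Minkowski n) := {x | form x x = -1 ∧ 0 < x 0}

/-- The hyperbolic plane `W ∩ ℍⁿ` cut out by a linear subspace `W`
(all of `ℍⁿ` for `W = ⊤`). -/
def plane {n : ℕ} (W : Submodule ℝ (Minkowski n)) : Set (Minkowski n) :=
  {x | x ∈ W ∧ x ∈ space n}

/-- The hyperbolic metric on `space n`: `cosh ρ(x, y) = - (x, y)`. -/
noncomputable def rho {n : ℕ} (x y : Minkowski n) : ℝ := Real.arcosh (-form x y)

/-- The distance between two subsets of hyperbolic space. -/
noncomputable def setDist {n : ℕ} (A B : Set (Minkowski n)) : ℝ :=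
  sInf {d : ℝ | ∃ x ∈ A, ∃ y ∈ B, d = rho x y}

/-- `P` is a convex polytope in the hyperbolic space `plane W`: the intersection of finitely many
closed half-spaces `{x ∈ plane W | (x, e) ≤ 0}`, `(e, e) = 1`, with non-empty interior
in `plane W`. -/
structure IsConvexPolytope {n : ℕ} (W : Submodule ℝ (Minkowski n)) (P : Set (Minkowski n)) :
    Prop where
  exists_halfSpaces : ∃ S : Set (Minkowski n), S.Finite ∧ (∀ e ∈ S, e ∈ W ∧ form e e = 1) ∧
    P = {x | x ∈ plane W ∧ ∀ e ∈ S, form x e ≤ 0}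
  nonempty_interior : ∃ U : Set (Minkowski n), IsOpen U ∧ (U ∩ plane W).Nonempty ∧
    U ∩ plane W ⊆ P

/-- `F` is a (non-empty) face of `P`: the set of points of `P` where a linear inequality
`(x, e) ≤ 0` that is valid on `P` is an equality. For `e = 0` this is `P` itself. -/
def IsFace {n : ℕ} (P F : Set (Minkowski n)) : Prop :=
  F.Nonempty ∧ ∃ e : Minkowski n, (∀ x ∈ P, form x e ≤ 0) ∧ F = {x | x ∈ P ∧ form x e = 0}

/-- `A` has dimension `k`: the smallest hyperbolic plane containing `A` is `k`-dimensional, that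
is, the linear span of `A` has dimension `k + 1`. -/
def HasDim {n : ℕ} (A : Set (Minkowski n)) (k : ℕ) : Prop :=
  Module.finrank ℝ (Submodule.span ℝ A) = k + 1

/-- Facets of `P`: faces of codimension one in `P`. -/
def IsFacet {n : ℕ} (P F : Set (Minkowski n)) : Prop :=
  IsFace P F ∧ ∃ k : ℕ, HasDim P (k + 1) ∧ HasDim F k

/-- `u` is the unit outer normal, in the hyperbolic space `plane W`, of the facet `F` of `P`. -/
structure IsOuterNormal {n : ℕ} (W : Submodule ℝ (Minkowski n)) (P F : Set (Minkowski n))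
    (u : Minkowski n) : Prop where
  mem : u ∈ W
  unit : form u u = 1
  nonpos : ∀ x ∈ P, form x u ≤ 0
  facet_eq : F = {x | x ∈ P ∧ form x u = 0}

/-- The dihedral angle of `{x | (x, u) ≤ 0} ∩ {x | (x, v) ≤ 0}`, for unit vectors `u`, `v` whose
orthogonal hyperplanes intersect in hyperbolic space: `cos α = - (u, v)`. -/
noncomputable def dihedralAngle {n : ℕ} (u v : Minkowski n) : ℝ := Real.arccos (-form u v)

/-- `P` is a Coxeter polytope in the hyperbolic space `plane W`: a convex polytope such that the
bounding hyperplanes of any two distinct facets either do not intersect or form a dihedral angle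
`π / k` with an integer `k ≥ 2`. -/
structure IsCoxeterPolytope {n : ℕ} (W : Submodule ℝ (Minkowski n)) (P : Set (Minkowski n)) :
    Prop extends IsConvexPolytope W P where
  angles : ∀ (F G : Set (Minkowski n)) (u v : Minkowski n),
    IsFacet P F → IsFacet P G → F ≠ G → IsOuterNormal W P F u → IsOuterNormal W P G v →
    (∃ x ∈ plane W, form x u = 0 ∧ form x v = 0) →
    ∃ k : ℕ, 2 ≤ k ∧ dihedralAngle u v = Real.pi / k

/-- The facet `F` of `P` is a framing facet of the edge `E`: it contains a vertex of `E`,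
but not `E` itself. -/
def IsFraming {n : ℕ} (P E F : Set (Minkowski n)) : Prop :=
  IsFacet P F ∧ ¬ E ⊆ F ∧ ∃ v : Minkowski n, IsFace E {v} ∧ v ∈ F

/-- The ridge of the polytope `P` in `ℍⁿ` associated with the edge `E`: the `n - 1` facets
`F 0, …, F (n - 2)` of `P` containing `E` and the two framing facets `G 0`, `G 1` of `E`. -/
structure IsRidge {n : ℕ} (P E : Set (Minkowski n)) (F : Fin (n - 1) → Set (Minkowski n))
    (G : Fin 2 → Set (Minkowski n)) : Prop where
  isFace : IsFace P E
  dim_one : HasDim E 1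
  injective : Function.Injective F
  range_eq : Set.range F = {A | IsFacet P A ∧ E ⊆ A}
  framing_injective : Function.Injective G
  range_framing_eq : Set.range G = {A | IsFraming P E A}

/-- The width of a ridge with framing facets `G 0`, `G 1`: the hyperbolic cosine of their
distance. -/
noncomputable def width {n : ℕ} (G : Fin 2 → Set (Minkowski n)) : ℝ :=
  Real.cosh (setDist (G 0) (G 1))

end HypGeom

namespace HypGeom

/-! ### The Minkowski form and causal vectors. -/

open Filter Topology

variable {n : ℕ}

/-! The estimate takes place in the compact 3-dimensional Coxeter polytope P'. Fix O in its interior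
and, among pairs of facets of P' with a common point, choose the one whose common line is farthest
from O. It carries an outermost edge. Let u₁, u₂ be the normals of its two facets, u₃, u₄ its
framing normals in P', u and v the projections of u₃ and u₄ to the orthogonal complement of u₁, u₂,
and D the squared hyperbolic sine of the distance from O to the line.

At each endpoint, maximality says that the other two edge lines through this vertex are no farther
from O. Since the cosines of the dihedral angles are cos(π/k), this forces (u,u)/2 · D + (O,u)² ≤
2.87 D, and likewise for v (`vertex_bound`, `exists_projection`). The signature of the form turns
the two estimates into -(u,v) ≤ 5.74, and nonpositive products of normals give -(u₃,u₄) ≤ -(u,v)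
(`neg_form_framing_lt`). The same nonpositivity puts the feet of the common perpendicular, or a
common point, on the framing facets themselves (`exists_near_points`), so the edge is narrow in P'
(`exists_narrow_edge`).

A Coxeter polytope is simple (`linearIndependent_active`). Hence the edge, seen in P, lies in
exactly n - 1 facets and has one framing facet at each end (`exists_isRidge`). The framing facets in
P' lie in those in P (`cut_framing_subset`), so passing to P cannot increase the distance. -/

lemma form_comm (x y : Minkowski n) : form x y = form y x := by
  simp only [form, mul_comm]

lemma form_add_left (x y z : Minkowski n) : form (x + y) z = form x z + form y z := by
  simp only [form, Pi.add_apply, add_mul, Finset.sum_add_distrib]; ring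

lemma form_smul_left (a : ℝ) (x z : Minkowski n) : form (a • x) z = a * form x z := by
  simp only [form, Pi.smul_apply, smul_eq_mul, mul_add, Finset.mul_sum, mul_assoc]; ring

lemma form_add_right (x y z : Minkowski n) : form x (y + z) = form x y + form x z := by
  rw [form_comm, form_add_left, form_comm y, form_comm z]

lemma form_smul_right (a : ℝ) (x z : Minkowski n) : form x (a • z) = a * form x z := by
  rw [form_comm, form_smul_left, form_comm]

/-- The Minkowski inner product as a bilinear form. -/
noncomputable def bilin (n : ℕ) : LinearMap.BilinForm ℝ (Minkowski n) :=
  LinearMap.mk₂ ℝ form form_add_left form_smul_left form_add_right form_smul_right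

@[simp] lemma bilin_apply (x y : Minkowski n) : bilin n x y = form x y := rfl

lemma form_neg_left (x z : Minkowski n) : form (-x) z = -form x z := (bilin n).neg_left x z

lemma form_neg_right (x z : Minkowski n) : form x (-z) = -form x z := (bilin n).neg_right x z

lemma form_sub_left (x y z : Minkowski n) : form (x - y) z = form x z - form y z := (bilin n).sub_left x y z

lemma form_sub_right (x y z : Minkowski n) : form x (y - z) = form x y - form x z := (bilin n).sub_right x y z

@[simp] lemma form_zero_left (z : Minkowski n) : form 0 z = 0 := (bilin n).zero_left z

@[simp] lemma form_zero_right (z : Minkowski n) : form z 0 = 0 := (bilin n).zero_right z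

lemma form_sum_right {ι : Type*} (s : Finset ι) (z : Minkowski n) (f : ι → Minkowski n) :
    form z (∑ i ∈ s, f i) = ∑ i ∈ s, form z (f i) :=
  map_sum (bilin n z) f s

lemma continuous_form {X : Type*} [TopologicalSpace X] {f g : X → Minkowski n}
    (hf : Continuous f) (hg : Continuous g) : Continuous fun x => form (f x) (g x) := by
  unfold form; fun_prop

/-- A vector orthogonal to a timelike vector is spacelike. -/
lemma form_self_pos {z w : Minkowski n} (hz : form z z < 0) (hzw : form z w = 0) (hw : w ≠ 0) :
    0 < form w w := by
  have cs : (∑ i : Fin n, z i.succ * w i.succ) ^ 2 ≤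
      (∑ i : Fin n, z i.succ ^ 2) * ∑ i : Fin n, w i.succ ^ 2 :=
    Finset.sum_mul_sq_le_sq_mul_sq _ _ _
  simp only [form, ← sq] at *
  have hw0 : 0 ≤ ∑ i : Fin n, w i.succ ^ 2 := Finset.sum_nonneg fun i _ => sq_nonneg _
  have hz0 : 0 ≤ ∑ i : Fin n, z i.succ ^ 2 := Finset.sum_nonneg fun i _ => sq_nonneg _
  have e : ∑ i : Fin n, z i.succ * w i.succ = z 0 * w 0 := by linarith
  rw [e] at cs
  rcases hw0.eq_or_lt with h | h
  · exfalso
    have h1 : ∀ i : Fin n, w i.succ = 0 := fun i => by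
      have := (Finset.sum_eq_zero_iff_of_nonneg (fun i _ => sq_nonneg (w (Fin.succ i)))).1 h.symm i
        (Finset.mem_univ _)
      simpa using this
    simp only [h1, mul_zero, Finset.sum_const_zero] at e
    have : w 0 = 0 := by
      rcases mul_eq_zero.1 e.symm with h2 | h2
      · rw [h2] at hz; nlinarith
      · exact h2
    exact hw (funext fun i => Fin.cases this h1 i)
  · by_contra! hc
    have h2 : ∑ i : Fin n, w i.succ ^ 2 ≤ w 0 ^ 2 := by linarith
    nlinarith

lemma form_self_nonneg {z w : Minkowski n} (hz : form z z < 0) (hzw : form z w = 0) :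
    0 ≤ form w w := by
  rcases eq_or_ne w 0 with rfl | hw
  · simp
  · exact (form_self_pos hz hzw hw).le

lemma abs_lt_of_timelike {x : Minkowski n} (hx : form x x < 0) :
    ∑ i : Fin n, x i.succ ^ 2 < x 0 ^ 2 := by
  simp only [form, ← sq] at hx; linarith

/-- Two future timelike vectors have negative product. -/
lemma form_neg_of_future {x y : Minkowski n} (hx : form x x < 0) (hx0 : 0 < x 0)
    (hy : form y y < 0) (hy0 : 0 < y 0) : form x y < 0 := by
  have cs : (∑ i : Fin n, x i.succ * y i.succ) ^ 2 ≤
      (∑ i : Fin n, x i.succ ^ 2) * ∑ i : Fin n, y i.succ ^ 2 :=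
    Finset.sum_mul_sq_le_sq_mul_sq _ _ _
  have h1 := abs_lt_of_timelike hx
  have h2 := abs_lt_of_timelike hy
  have h3 : 0 ≤ ∑ i : Fin n, x i.succ ^ 2 := Finset.sum_nonneg fun i _ => sq_nonneg _
  have h4 : 0 ≤ ∑ i : Fin n, y i.succ ^ 2 := Finset.sum_nonneg fun i _ => sq_nonneg _
  have h5 : (∑ i : Fin n, x i.succ * y i.succ) ^ 2 < (x 0 * y 0) ^ 2 := by
    rw [mul_pow]
    exact cs.trans_lt (mul_lt_mul'' h1 h2 h3 h4)
  have := lt_of_pow_lt_pow_left₀ 2 (mul_pos hx0 hy0).le h5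
  simp only [form]; linarith

/-- A timelike vector having negative product with a point of hyperbolic space is future. -/
lemma future_of_form_neg {x y : Minkowski n} (hx : x ∈ space n) (hy : form y y < 0)
    (hxy : form x y < 0) : 0 < y 0 := by
  by_contra! h
  have hx1 : form x x < 0 := by rw [hx.1]; norm_num
  rcases h.eq_or_lt with h | h
  · simp only [form, h, ← sq] at hy
    have : 0 ≤ ∑ i : Fin n, y i.succ ^ 2 := Finset.sum_nonneg fun i _ => sq_nonneg _
    nlinarith
  · have := form_neg_of_future hx1 hx.2 (y := -y)
      (by rwa [form_neg_left, form_neg_right, neg_neg]) (by simpa using h)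
    rw [form_neg_right] at this
    linarith

lemma form_le_neg_one {x y : Minkowski n} (hx : x ∈ space n) (hy : y ∈ space n) :
    form x y ≤ -1 := by
  have h1 : form x x < 0 := by rw [hx.1]; norm_num
  have h2 : form y y < 0 := by rw [hy.1]; norm_num
  have h := form_neg_of_future h1 hx.2 h2 hy.2
  -- The component of `y` orthogonal to `x` is spacelike, so the square of `form x y` is at least 1.
  have h3 : 0 ≤ form (y + form x y • x) (y + form x y • x) := by
    apply form_self_nonneg h1
    rw [form_add_right, form_smul_right, hx.1]; ring
  simp only [form_add_right, form_smul_right, form_add_left, form_smul_left, hx.1, hy.1,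
    form_comm y x] at h3
  nlinarith

/-- A causal vector has a constant sign on hyperbolic space. -/
lemma causal_sign {x y w : Minkowski n} (hx : x ∈ space n) (hy : y ∈ space n)
    (hw : form w w ≤ 0) (h1 : form x w < 0) (h2 : 0 < form y w) : False := by
  have hx1 : form x x < 0 := by rw [hx.1]; norm_num
  have hy1 : form y y < 0 := by rw [hy.1]; norm_num
  have h3 := form_neg_of_future hx1 hx.2 hy1 hy.2
  -- A combination of `x` and `y` with positive coefficients is timelike; this one is orthogonal to
  -- `w`, which is therefore spacelike.
  set z := form y w • x - form x w • y with hz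
  have hzw : form z w = 0 := by
    rw [hz, form_sub_left, form_smul_left, form_smul_left]; ring
  have hzz : form z z < 0 := by
    simp only [hz, form_sub_left, form_smul_left, form_sub_right, form_smul_right, form_comm y x]
    have := mul_pos h2 (neg_pos.2 h1)
    nlinarith [mul_pos h2 h2, mul_pos (neg_pos.2 h1) (neg_pos.2 h1), mul_pos this (neg_pos.2 h3)]
  have hw0 : w ≠ 0 := by rintro rfl; simp at h1
  exact absurd (form_self_pos hzz hzw hw0) (not_lt.2 hw)

lemma exists_smul_mem_space {z : Minkowski n} (hz : form z z < 0) (h0 : 0 < z 0) :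
    ∃ r : ℝ, 0 < r ∧ r ^ 2 * -form z z = 1 ∧ r • z ∈ space n := by
  have hs := Real.sqrt_pos.2 (neg_pos.2 hz)
  have h2 := Real.sq_sqrt (neg_pos.2 hz).le
  have h3 : (√(-form z z))⁻¹ ^ 2 * -form z z = 1 := by
    rw [inv_pow, h2, inv_mul_cancel₀ (neg_pos.2 hz).ne']
  refine ⟨(√(-form z z))⁻¹, inv_pos.2 hs, h3, ?_, ?_⟩
  · rw [form_smul_left, form_smul_right]; linarith
  · simpa using mul_pos (inv_pos.2 hs) h0

lemma future_add_smul {x w : Minkowski n} (hx : x ∈ space n) :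
    ∀ᶠ s in 𝓝 (0 : ℝ), form (x + s • w) (x + s • w) < 0 ∧ 0 < (x + s • w) 0 := by
  have hx1 : form x x < 0 := by rw [hx.1]; norm_num
  have c1 : Continuous fun s : ℝ => form (x + s • w) (x + s • w) :=
    continuous_form (by fun_prop) (by fun_prop)
  have c2 : Continuous fun s : ℝ => (x + s • w) 0 := by fun_prop
  have t1 := c1.tendsto 0
  have t2 := c2.tendsto 0
  simp only [zero_smul, add_zero] at t1 t2
  exact (t1.eventually (gt_mem_nhds hx1)).and (t2.eventually (lt_mem_nhds hx.2))

/-- Projecting a point of hyperbolic space to the orthogonal complement of two unit vectors that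
span a positive definite plane and whose product with the point is nonpositive. -/
lemma exists_meet {W : Submodule ℝ (Minkowski n)} {O u v : Minkowski n} (hO : O ∈ plane W)
    (hu : u ∈ W) (hv : v ∈ W) (huu : form u u = 1) (hvv : form v v = 1)
    (h1 : -1 < form u v) (h2 : form u v < 1) :
    ∃ a b r : ℝ, 0 < r ∧ (form u v ≤ 0 → form O u ≤ 0 → form O v ≤ 0 → 0 ≤ a ∧ 0 ≤ b) ∧
      r • (O + a • u + b • v) ∈ plane W ∧
      form (r • (O + a • u + b • v)) u = 0 ∧ form (r • (O + a • u + b • v)) v = 0 := by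
  set g := form u v with hg
  have hd : 0 < 1 - g ^ 2 := by nlinarith
  set x := form O u with hx
  set y := form O v with hy
  set a := (g * y - x) / (1 - g ^ 2) with ha
  set b := (g * x - y) / (1 - g ^ 2) with hb
  have e1 : x + a + b * g = 0 := by rw [ha, hb]; field_simp; ring
  have e2 : y + a * g + b = 0 := by rw [ha, hb]; field_simp; ring
  have z1 : form (O + a • u + b • v) u = 0 := by
    simp only [form_add_left, form_smul_left, huu, form_comm v u, ← hg, ← hx]; linarith
  have z2 : form (O + a • u + b • v) v = 0 := by
    simp only [form_add_left, form_smul_left, hvv, ← hg, ← hy]; linarith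
  have hOz : form O (O + a • u + b • v) = -1 + a * x + b * y := by
    simp only [form_add_right, form_smul_right, hO.2.1, ← hx, ← hy]
  have hq : a * x + b * y ≤ 0 := by
    -- Completing the square shows that the projection stays timelike.
    have : a * x + b * y = -((x - g * y) ^ 2 / (1 - g ^ 2) + y ^ 2) := by
      rw [ha, hb]; field_simp; ring
    rw [this]
    have := div_nonneg (sq_nonneg (x - g * y)) hd.le
    nlinarith [sq_nonneg y]
  have hzz : form (O + a • u + b • v) (O + a • u + b • v) < 0 := by
    have : form (O + a • u + b • v) (O + a • u + b • v) = form O (O + a • u + b • v) := by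
      rw [form_add_left, form_add_left, form_smul_left, form_smul_left, form_comm u, form_comm v,
        z1, z2]; ring
    rw [this, hOz]; linarith
  obtain ⟨r, hr, -, hrs⟩ := exists_smul_mem_space hzz
    (future_of_form_neg hO.2 hzz (by rw [hOz]; linarith))
  refine ⟨a, b, r, hr, fun hg0 hx0 hy0 => ⟨?_, ?_⟩, ⟨?_, hrs⟩, ?_, ?_⟩
  · exact div_nonneg (by nlinarith) hd.le
  · exact div_nonneg (by nlinarith) hd.le
  · exact W.smul_mem _ (W.add_mem (W.add_mem hO.1 (W.smul_mem _ hu)) (W.smul_mem _ hv))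
  · rw [form_smul_left, z1, mul_zero]
  · rw [form_smul_left, z2, mul_zero]

/-! ### Half-space presentations and faces described by active normals. -/

/-- `S` is a finite set of unit outer normals of half-spaces whose intersection is `P`. -/
structure IsPresentation (W : Submodule ℝ (Minkowski n)) (P : Set (Minkowski n))
    (S : Finset (Minkowski n)) : Prop where
  mem : ∀ e ∈ S, e ∈ W
  unit : ∀ e ∈ S, form e e = 1
  eq : P = {x | x ∈ plane W ∧ ∀ e ∈ S, form x e ≤ 0}
  interior : ∃ O ∈ plane W, ∀ e ∈ S, form O e < 0

/-- The normals in `S` orthogonal to `x`. -/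
noncomputable def active (S : Finset (Minkowski n)) (x : Minkowski n) : Finset (Minkowski n) :=
  S.filter fun e => form x e = 0

lemma mem_active {S : Finset (Minkowski n)} {x e : Minkowski n} :
    e ∈ active S x ↔ e ∈ S ∧ form x e = 0 := by simp [active]

/-- The part of `P` orthogonal to all vectors of `A`. -/
def cut (P : Set (Minkowski n)) (A : Finset (Minkowski n)) : Set (Minkowski n) :=
  {z | z ∈ P ∧ ∀ e ∈ A, form z e = 0}

/-- The orthogonal complement of `A` in `W`. -/
def perp (W : Submodule ℝ (Minkowski n)) (A : Finset (Minkowski n)) :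
    Submodule ℝ (Minkowski n) where
  carrier := {w | w ∈ W ∧ ∀ e ∈ A, form w e = 0}
  add_mem' := fun ⟨h1, h2⟩ ⟨h3, h4⟩ => ⟨W.add_mem h1 h3, fun e he => by
    rw [form_add_left, h2 e he, h4 e he, add_zero]⟩
  zero_mem' := ⟨W.zero_mem, fun e _ => form_zero_left e⟩
  smul_mem' := fun a w ⟨h1, h2⟩ => ⟨W.smul_mem a h1, fun e he => by
    rw [form_smul_left, h2 e he, mul_zero]⟩

lemma mem_perp {W : Submodule ℝ (Minkowski n)} {A : Finset (Minkowski n)} {w : Minkowski n} :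
    w ∈ perp W A ↔ w ∈ W ∧ ∀ e ∈ A, form w e = 0 := Iff.rfl

/-- The span of `A` lies in the positive definite complement of `x`, so pairing with the elements of
`A` is injective on it, hence bijective by dimension. -/
lemma exists_mem_span_form_eq {x : Minkowski n} (hx : form x x < 0) {A : Finset (Minkowski n)}
    (hA : ∀ e ∈ A, form x e = 0) (hli : LinearIndependent ℝ (fun e : A => (e : Minkowski n)))
    (φ : Minkowski n → ℝ) :
    ∃ w ∈ Submodule.span ℝ (A : Set (Minkowski n)), ∀ e ∈ A, form w e = φ e := by
  let T : Submodule.span ℝ (A : Set (Minkowski n)) →ₗ[ℝ] (A → ℝ) :=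
    LinearMap.pi fun e => (bilin n).flip e ∘ₗ Submodule.subtype _
  have hT : ∀ w (e : A), T w e = form (w : Minkowski n) (e : Minkowski n) := fun _ _ => rfl
  have inj : Function.Injective T := by
    rw [injective_iff_map_eq_zero]
    intro w hw
    by_contra hne
    have h1 : ∀ e ∈ A, form (w : Minkowski n) e = 0 := fun e he => by
      rw [← hT w ⟨e, he⟩, hw]; rfl
    have key : ∀ y z : Minkowski n, (∀ e ∈ A, form y e = 0) →
        z ∈ Submodule.span ℝ (A : Set (Minkowski n)) → form y z = 0 := by
      intro y z hy hz
      induction hz using Submodule.span_induction with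
      | mem e he => exact hy e he
      | zero => simp
      | add a b _ _ ha hb => rw [form_add_right, ha, hb, add_zero]
      | smul c a _ ha => rw [form_smul_right, ha, mul_zero]
    have h2 := form_self_pos hx (key x w hA w.2) (fun h => hne (Subtype.ext h))
    rw [key w w h1 w.2] at h2
    exact lt_irrefl _ h2
  have hdim : Module.finrank ℝ (Submodule.span ℝ (A : Set (Minkowski n))) =
      Module.finrank ℝ (A → ℝ) := by
    have := finrank_span_eq_card hli
    rw [Subtype.range_coe_subtype] at this
    simpa using this
  obtain ⟨w, hw⟩ := (LinearMap.injective_iff_surjective_of_finrank_eq_finrank hdim).1 inj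
    fun e => φ e
  exact ⟨w, w.2, fun e he => by rw [← hT w ⟨e, he⟩, hw]⟩

lemma finrank_perp {W : Submodule ℝ (Minkowski n)} {x : Minkowski n} (hx : form x x < 0)
    {A : Finset (Minkowski n)} (hAW : ∀ e ∈ A, e ∈ W) (hA : ∀ e ∈ A, form x e = 0)
    (hli : LinearIndependent ℝ (fun e : A => (e : Minkowski n))) :
    Module.finrank ℝ (perp W A) + A.card = Module.finrank ℝ W := by
  let T : W →ₗ[ℝ] (A → ℝ) := LinearMap.pi fun e => (bilin n).flip e ∘ₗ Submodule.subtype _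
  have hT : ∀ w (e : A), T w e = form (w : Minkowski n) (e : Minkowski n) := fun _ _ => rfl
  have hsurj : LinearMap.range T = ⊤ := by
    rw [LinearMap.range_eq_top]
    intro φ
    obtain ⟨w, hw, h⟩ := exists_mem_span_form_eq hx hA hli
      (fun e => if he : e ∈ A then φ ⟨e, he⟩ else 0)
    refine ⟨⟨w, Submodule.span_le.2 (fun e he => hAW e he) hw⟩, ?_⟩
    ext e
    rw [hT]
    simp [h e e.2]
  have hker : (LinearMap.ker T).map W.subtype = perp W A := by
    ext w
    simp only [Submodule.mem_map, LinearMap.mem_ker, Submodule.subtype_apply, mem_perp]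
    constructor
    · rintro ⟨y, hy, rfl⟩
      exact ⟨y.2, fun e he => by rw [← hT y ⟨e, he⟩, hy]; rfl⟩
    · rintro ⟨h1, h2⟩
      exact ⟨⟨w, h1⟩, by ext e; rw [hT]; exact h2 e e.2, rfl⟩
  have h1 := LinearMap.finrank_range_add_finrank_ker T
  rw [hsurj, finrank_top] at h1
  have h2 : Module.finrank ℝ (perp W A) = Module.finrank ℝ (LinearMap.ker T) := by
    rw [← hker]
    exact Submodule.finrank_map_subtype_eq W _
  rw [h2, ← h1, add_comm]
  simp

namespace IsPresentation

variable {W : Submodule ℝ (Minkowski n)} {P : Set (Minkowski n)} {S : Finset (Minkowski n)}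

lemma mem_iff (H : IsPresentation W P S) {x : Minkowski n} :
    x ∈ P ↔ x ∈ plane W ∧ ∀ e ∈ S, form x e ≤ 0 := by
  conv_lhs => rw [H.eq]
  rfl

lemma mem_space (H : IsPresentation W P S) {x : Minkowski n} (hx : x ∈ P) : x ∈ space n :=
  (H.mem_iff.1 hx).1.2

lemma mem_W (H : IsPresentation W P S) {x : Minkowski n} (hx : x ∈ P) : x ∈ W :=
  (H.mem_iff.1 hx).1.1

lemma timelike (H : IsPresentation W P S) {x : Minkowski n} (hx : x ∈ P) : form x x < 0 := by
  rw [(H.mem_space hx).1]; norm_num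

/-- Moving a point of `P` a little in a direction allowed by its active normals. -/
lemma step (H : IsPresentation W P S) {x w : Minkowski n} (hx : x ∈ P) (hw : w ∈ W)
    (h : ∀ e ∈ active S x, form w e ≤ 0) :
    ∃ s r : ℝ, 0 < s ∧ 0 < r ∧ r • (x + s • w) ∈ P ∧
      active S (r • (x + s • w)) = (active S x).filter fun e => form w e = 0 := by
  have hx' := H.mem_iff.1 hx
  have h1 : ∀ᶠ s in 𝓝 (0 : ℝ), ∀ e ∈ S, form x e < 0 → form (x + s • w) e < 0 := by
    rw [Filter.eventually_all_finset]
    intro e _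
    by_cases he : form x e < 0
    · have c : Continuous fun s : ℝ => form (x + s • w) e :=
        continuous_form (by fun_prop) (by fun_prop)
      have t := c.tendsto 0
      simp only [zero_smul, add_zero] at t
      filter_upwards [t.eventually (gt_mem_nhds he)] with s hs _ using hs
    · exact Eventually.of_forall fun s hs => absurd hs he
  obtain ⟨s, ⟨⟨hs1, hs2⟩, hs3⟩, hs0 : 0 < s⟩ :=
    ((((future_add_smul (w := w) hx'.1.2).and h1).filter_mono nhdsWithin_le_nhds).and
      (self_mem_nhdsWithin (a := (0 : ℝ)) (s := Set.Ioi 0))).exists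
  obtain ⟨r, hr, -, hrs⟩ := exists_smul_mem_space hs1 hs2
  refine ⟨s, r, hs0, hr, H.mem_iff.2 ⟨⟨?_, hrs⟩, fun e he => ?_⟩, ?_⟩
  · exact W.smul_mem _ (W.add_mem hx'.1.1 (W.smul_mem _ hw))
  · rw [form_smul_left]
    refine mul_nonpos_of_nonneg_of_nonpos hr.le ?_
    rcases (hx'.2 e he).eq_or_lt with h0 | h0
    · rw [form_add_left, form_smul_left, h0, zero_add]
      exact mul_nonpos_of_nonneg_of_nonpos hs0.le (h e (mem_active.2 ⟨he, h0⟩))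
    · exact (hs3 e he h0).le
  · ext e
    simp only [Finset.mem_filter, mem_active, and_assoc, form_smul_left, mul_eq_zero, hr.ne',
      false_or]
    refine and_congr_right fun he => ?_
    rcases (hx'.2 e he).eq_or_lt with h0 | h0
    · simp [form_add_left, form_smul_left, h0, hs0.ne']
    · simp [h0.ne, (hs3 e he h0).ne]

/-- Every direction orthogonal to the active normals can be followed a little inside the face, and
is recovered from the two endpoints of that move. -/
lemma span_cut (H : IsPresentation W P S) {x : Minkowski n} (hx : x ∈ P) :
    Submodule.span ℝ (cut P (active S x)) = perp W (active S x) := by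
  apply le_antisymm
  · rw [Submodule.span_le]
    exact fun z hz => ⟨H.mem_W hz.1, hz.2⟩
  · intro w hw
    obtain ⟨s, r, hs, hr, h1, h2⟩ := H.step hx hw.1 fun e he => (hw.2 e he).le
    have hxc : x ∈ Submodule.span ℝ (cut P (active S x)) :=
      Submodule.subset_span ⟨hx, fun e he => (mem_active.1 he).2⟩
    have hyc : r • (x + s • w) ∈ Submodule.span ℝ (cut P (active S x)) :=
      Submodule.subset_span ⟨h1, fun e he => by
        rw [form_smul_left, form_add_left, form_smul_left, hw.2 e he, (mem_active.1 he).2]; ring⟩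
    have e : w = s⁻¹ • (r⁻¹ • (r • (x + s • w)) - x) := by
      rw [smul_smul, inv_mul_cancel₀ hr.ne', one_smul, add_sub_cancel_left, smul_smul,
        inv_mul_cancel₀ hs.ne', one_smul]
    rw [e]
    exact Submodule.smul_mem _ _ (Submodule.sub_mem _ (Submodule.smul_mem _ _ hyc) hxc)

/-- A point is extended beyond `x` from any point of the smallest face containing `x`. -/
lemma extend (H : IsPresentation W P S) {x z : Minkowski n} (hx : x ∈ P)
    (hz : z ∈ cut P (active S x)) :
    ∃ s r : ℝ, 0 < s ∧ 0 < r ∧ r • (x - s • z) ∈ P := by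
  obtain ⟨s, r, hs, hr, h, -⟩ := H.step hx (W.neg_mem (H.mem_W hz.1))
    fun e he => by rw [form_neg_left, hz.2 e he, neg_zero]
  exact ⟨s, r, hs, hr, by simpa [sub_eq_add_neg] using h⟩

/-- If a valid inequality is an equality at `x`, it is an equality on the smallest face containing
`x`. -/
lemma eq_zero_of_valid {Q : Set (Minkowski n)} {x z g : Minkowski n}
    (hx : form x g = 0) (hz : z ∈ Q) (hg : ∀ y ∈ Q, form y g ≤ 0)
    (h : ∃ s r : ℝ, 0 < s ∧ 0 < r ∧ r • (x - s • z) ∈ Q) : form z g = 0 := by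
  obtain ⟨s, r, hs, hr, hy⟩ := h
  have h1 := hg _ hy
  rw [form_smul_left, form_sub_left, form_smul_left, hx, zero_sub, mul_neg, ← mul_assoc] at h1
  have h2 := hg z hz
  have := mul_pos hr hs
  nlinarith

/-- A face is cut out by the normals active at one of its points. -/
lemma face_eq_cut (H : IsPresentation W P S) {F : Set (Minkowski n)} (hF : IsFace P F) :
    ∃ x ∈ F, F = cut P (active S x) := by
  obtain ⟨⟨x0, hx0⟩, g, hg, hFg⟩ := hF
  -- A point of `F` with fewest active normals serves as a relative interior point.
  have : ∃ k, ∃ x ∈ F, (active S x).card = k := ⟨_, x0, hx0, rfl⟩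
  classical
  obtain ⟨x, hx, hk⟩ := Nat.find_spec this
  have hmin : ∀ y ∈ F, (active S x).card ≤ (active S y).card := fun y hy => by
    rw [hk]; exact Nat.find_min' this ⟨y, hy, rfl⟩
  have hFP : ∀ y ∈ F, y ∈ P ∧ form y g = 0 := fun y hy => by rwa [hFg] at hy
  have hxP := hFP x hx
  refine ⟨x, hx, Set.Subset.antisymm (fun y hy => ⟨(hFP y hy).1, ?_⟩) fun z hz => ?_⟩
  -- Moving from `x` towards `y` would deactivate each normal not vanishing at `y`; minimality
  -- leaves none.
  · obtain ⟨s, r, hs, hr, h1, h2⟩ := H.step hxP.1 (H.mem_W (hFP y hy).1)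
      fun e he => (H.mem_iff.1 (hFP y hy).1).2 e (mem_active.1 he).1
    have h3 : r • (x + s • y) ∈ F := by
      rw [hFg]
      exact ⟨h1, by rw [form_smul_left, form_add_left, form_smul_left, hxP.2, (hFP y hy).2]; ring⟩
    have h4 := hmin _ h3
    rw [h2] at h4
    have h5 := Finset.eq_of_subset_of_card_le (Finset.filter_subset _ _) h4
    intro e he
    rw [← h5] at he
    exact (Finset.mem_filter.1 he).2
  · rw [hFg]
    exact ⟨hz.1, eq_zero_of_valid hxP.2 hz.1 hg (H.extend hxP.1 hz)⟩

lemma cut_isFace (H : IsPresentation W P S) {x : Minkowski n} (hx : x ∈ P)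
    {A : Finset (Minkowski n)} (hA : A ⊆ active S x) : IsFace P (cut P A) := by
  have h : ∀ z ∈ P, ∀ e ∈ A, form z e ≤ 0 := fun z hz e he =>
    (H.mem_iff.1 hz).2 e (mem_active.1 (hA he)).1
  -- A sum of nonpositive terms vanishes only if each does, so one inequality encodes all of `A`.
  refine ⟨⟨x, hx, fun e he => (mem_active.1 (hA he)).2⟩, ∑ e ∈ A, e, fun z hz => ?_, ?_⟩
  · rw [form_sum_right]
    exact Finset.sum_nonpos (h z hz)
  · ext z
    refine and_congr_right fun hz => ?_
    rw [form_sum_right, Finset.sum_eq_zero_iff_of_nonpos (h z hz)]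

/-- The faces cut out by the normals active at `x` in a polytope and in a face of it agree. -/
lemma cut_active_eq (H : IsPresentation W P S) {W' : Submodule ℝ (Minkowski n)}
    {Q : Set (Minkowski n)} {S' : Finset (Minkowski n)} (H' : IsPresentation W' Q S')
    (hQ : IsFace P Q) {x : Minkowski n} (hx : x ∈ Q) :
    cut P (active S x) = cut Q (active S' x) := by
  obtain ⟨-, g, hg, hQg⟩ := hQ
  have hQP : ∀ y, y ∈ Q ↔ y ∈ P ∧ form y g = 0 := fun y => by rw [hQg]; rfl
  have hxP := (hQP x).1 hx
  ext z
  constructor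
  · intro hz
    have h0 := eq_zero_of_valid hxP.2 hz.1 hg (H.extend hxP.1 hz)
    have hzQ : z ∈ Q := (hQP z).2 ⟨hz.1, h0⟩
    refine ⟨hzQ, fun u hu => ?_⟩
    refine eq_zero_of_valid (mem_active.1 hu).2 hzQ
      (fun y hy => (H'.mem_iff.1 hy).2 u (mem_active.1 hu).1) ?_
    obtain ⟨s, r, hs, hr, h⟩ := H.extend hxP.1 hz
    exact ⟨s, r, hs, hr, (hQP _).2 ⟨h, by
      rw [form_smul_left, form_sub_left, form_smul_left, hxP.2, h0]; ring⟩⟩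
  · intro hz
    refine ⟨((hQP z).1 hz.1).1, fun e he => ?_⟩
    refine eq_zero_of_valid (Q := Q) (mem_active.1 he).2 hz.1
      (fun y hy => (H.mem_iff.1 ((hQP y).1 hy).1).2 e (mem_active.1 he).1) (H'.extend hx hz)

end IsPresentation

namespace IsPresentation

variable {W : Submodule ℝ (Minkowski n)} {P : Set (Minkowski n)} {S : Finset (Minkowski n)}

lemma interior_mem (H : IsPresentation W P S) :
    ∃ O ∈ P, (∀ e ∈ S, form O e < 0) ∧ active S O = ∅ := by
  obtain ⟨O, hO, h⟩ := H.interior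
  refine ⟨O, H.mem_iff.2 ⟨hO, fun e he => (h e he).le⟩, h, ?_⟩
  ext e
  simp only [mem_active, Finset.notMem_empty, iff_false, not_and]
  exact fun he => (h e he).ne

lemma span_eq (H : IsPresentation W P S) : Submodule.span ℝ P = W := by
  obtain ⟨O, hO, -, h⟩ := H.interior_mem
  have := H.span_cut hO
  rw [h] at this
  simp only [cut, perp, Finset.notMem_empty, false_imp_iff, implies_true, and_true,
    Set.ofPred_mem_eq] at this
  exact this

lemma finrank_perp (H : IsPresentation W P S) {x : Minkowski n} (hx : x ∈ P)
    {A : Finset (Minkowski n)} (hA : A ⊆ active S x)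
    (hli : LinearIndependent ℝ (fun e : A => (e : Minkowski n))) :
    Module.finrank ℝ (perp W A) + A.card = Module.finrank ℝ W ∧
      1 ≤ Module.finrank ℝ (perp W A) := by
  have h : ∀ e ∈ A, e ∈ S ∧ form x e = 0 := fun e he => mem_active.1 (hA he)
  refine ⟨HypGeom.finrank_perp (H.timelike hx) (fun e he => H.mem e (h e he).1)
    (fun e he => (h e he).2) hli, ?_⟩
  rw [Nat.one_le_iff_ne_zero]
  intro h0
  have hbot := Submodule.finrank_eq_zero.1 h0
  have hxm : x ∈ perp W A := ⟨H.mem_W hx, fun e he => (h e he).2⟩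
  rw [hbot, Submodule.mem_bot] at hxm
  have := H.timelike hx
  simp [hxm] at this

lemma isFacet_cut_singleton (H : IsPresentation W P S) {x e : Minkowski n} (hx : x ∈ P)
    (hxe : active S x = {e}) : IsFacet P (cut P {e}) := by
  have he : e ∈ S := (mem_active.1 (hxe ▸ Finset.mem_singleton_self e : e ∈ active S x)).1
  have hne : e ≠ 0 := by
    rintro rfl
    have := H.unit 0 he
    simp at this
  have hli : LinearIndependent ℝ (fun f : ({e} : Finset (Minkowski n)) => (f : Minkowski n)) := by
    have := LinearIndepOn.singleton (R := ℝ) (v := id) (i := e) hne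
    rw [← Finset.coe_singleton] at this
    exact this
  obtain ⟨h1, h2⟩ := H.finrank_perp hx hxe.ge hli
  rw [Finset.card_singleton] at h1
  refine ⟨H.cut_isFace hx hxe.ge, Module.finrank ℝ (perp W {e}) - 1, ?_, ?_⟩
  · rw [HasDim, H.span_eq]; omega
  · have := H.span_cut hx
    rw [hxe] at this
    rw [HasDim, this]; omega

lemma isOuterNormal (H : IsPresentation W P S) {e : Minkowski n} (he : e ∈ S) :
    IsOuterNormal W P (cut P {e}) e where
  mem := H.mem e he
  unit := H.unit e he
  nonpos := fun _ hx => (H.mem_iff.1 hx).2 e he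
  facet_eq := by ext x; simp [cut]

end IsPresentation

/-! ### Coxeter presentations: irredundancy, nonpositive products, simplicity. -/

/-- A presentation of a Coxeter polytope by the unit outer normals of its facets. -/
structure IsCoxeterPresentation (W : Submodule ℝ (Minkowski n)) (P : Set (Minkowski n))
    (S : Finset (Minkowski n)) : Prop extends IsPresentation W P S where
  facet_point : ∀ e ∈ S, ∃ x ∈ P, active S x = {e}
  nonpos : ∀ u ∈ S, ∀ v ∈ S, u ≠ v → form u v ≤ 0
  angle : ∀ u ∈ S, ∀ v ∈ S, u ≠ v → (∃ x ∈ plane W, form x u = 0 ∧ form x v = 0) →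
    ∃ k : ℕ, 2 ≤ k ∧ form u v = -Real.cos (Real.pi / k)

/-- An interior point satisfies all inequalities strictly: if `form O e = 0`, a short move along
`e`, rescaled to the hyperboloid, would stay in the open set yet violate `e`. -/
lemma IsConvexPolytope.exists_interior {W : Submodule ℝ (Minkowski n)} {P : Set (Minkowski n)}
    (hP : IsConvexPolytope W P) {S : Finset (Minkowski n)}
    (hS : ∀ e ∈ S, e ∈ W ∧ form e e = 1)
    (hPS : P = {x | x ∈ plane W ∧ ∀ e ∈ S, form x e ≤ 0}) : IsPresentation W P S where
  mem := fun e he => (hS e he).1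
  unit := fun e he => (hS e he).2
  eq := hPS
  interior := by
    obtain ⟨U, hU, ⟨O, hOU, hO⟩, hUP⟩ := hP.nonempty_interior
    refine ⟨O, hO, fun e he => ?_⟩
    have hOP : O ∈ P := hUP ⟨hOU, hO⟩
    rw [hPS] at hOP
    refine lt_of_le_of_ne (hOP.2 e he) fun h0 => ?_
    have c1 : Continuous fun s : ℝ => √(-form (O + s • e) (O + s • e)) :=
      Real.continuous_sqrt.comp (continuous_form (by fun_prop) (by fun_prop)).neg
    have c : ContinuousAt (fun s : ℝ => (√(-form (O + s • e) (O + s • e)))⁻¹ • (O + s • e)) 0 := by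
      refine ContinuousAt.smul (c1.continuousAt.inv₀ ?_) (by fun_prop)
      simp [hO.2.1]
    have hev : ∀ᶠ s in 𝓝 (0 : ℝ), (√(-form (O + s • e) (O + s • e)))⁻¹ • (O + s • e) ∈ U :=
      c.eventually_mem (hU.mem_nhds (by simpa [hO.2.1] using hOU))
    obtain ⟨s, ⟨⟨hs1, hs2⟩, hs3⟩, hs0 : 0 < s⟩ :=
      ((((future_add_smul (w := e) hO.2).and hev).filter_mono nhdsWithin_le_nhds).and
        (self_mem_nhdsWithin (a := (0 : ℝ)) (s := Set.Ioi 0))).exists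
    have hr := inv_pos.2 (Real.sqrt_pos.2 (neg_pos.2 hs1))
    set r := (√(-form (O + s • e) (O + s • e)))⁻¹ with hrdef
    have hr2 : r ^ 2 * -form (O + s • e) (O + s • e) = 1 := by
      rw [hrdef, inv_pow, Real.sq_sqrt (neg_pos.2 hs1).le, inv_mul_cancel₀ (neg_pos.2 hs1).ne']
    have hmem : r • (O + s • e) ∈ P := by
      refine hUP ⟨hs3, W.smul_mem _ (W.add_mem hO.1 (W.smul_mem _ (hS e he).1)), ?_, ?_⟩
      · rw [form_smul_left, form_smul_right]; linarith
      · simpa using mul_pos hr hs2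
    rw [hPS] at hmem
    have := hmem.2 e he
    rw [form_smul_left, form_add_left, form_smul_left, h0, (hS e he).2] at this
    nlinarith [mul_pos hr hs0]

/-- A convex polytope has a presentation without redundant half-spaces. -/
lemma IsConvexPolytope.exists_presentation {W : Submodule ℝ (Minkowski n)}
    {P : Set (Minkowski n)} (hP : IsConvexPolytope W P) :
    ∃ S, IsPresentation W P S ∧ ∀ e ∈ S, ∃ x ∈ P, active S x = {e} := by
  classical
  have hex : ∃ k, ∃ S : Finset (Minkowski n), (∀ e ∈ S, e ∈ W ∧ form e e = 1) ∧
      P = {x | x ∈ plane W ∧ ∀ e ∈ S, form x e ≤ 0} ∧ S.card = k := by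
    obtain ⟨S, hf, h1, h2⟩ := hP.exists_halfSpaces
    exact ⟨_, hf.toFinset, by simpa using h1, by simpa using h2, rfl⟩
  obtain ⟨S, hS, hPS, hk⟩ := Nat.find_spec hex
  have H := hP.exists_interior hS hPS
  refine ⟨S, H, fun e he => ?_⟩
  have hred : ∃ x ∈ plane W, (∀ f ∈ S.erase e, form x f ≤ 0) ∧ 0 < form x e := by
    by_contra! hc
    refine Nat.find_min hex (m := (S.erase e).card) (by
      rw [← hk]; exact Finset.card_erase_lt_of_mem he)
      ⟨S.erase e, fun f hf => hS f (Finset.mem_of_mem_erase hf), ?_, rfl⟩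
    ext x
    rw [H.mem_iff]
    constructor
    · exact fun h => ⟨h.1, fun f hf => h.2 f (Finset.mem_of_mem_erase hf)⟩
    · refine fun h => ⟨h.1, fun f hf => ?_⟩
      rcases eq_or_ne f e with rfl | hne
      · exact hc x h.1 h.2
      · exact h.2 f (Finset.mem_erase.2 ⟨hne, hf⟩)
  obtain ⟨x, hx, hxf, hxe⟩ := hred
  obtain ⟨O, hO, hOe⟩ := H.interior
  have hb := neg_pos.2 (hOe e he)
  -- Up to scale, the point where the segment from `O` to `x` crosses the hyperplane of `e`; the
  -- weight on `O` keeps every other inequality strict.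
  set z := form x e • O + (-form O e) • x with hz
  have hOx := form_le_neg_one hO.2 hx.2
  have hze : form z e = 0 := by rw [hz, form_add_left, form_smul_left, form_smul_left]; ring
  have hzf : ∀ f ∈ S, f ≠ e → form z f < 0 := fun f hf hne => by
    rw [hz, form_add_left, form_smul_left, form_smul_left]
    have h1 := mul_neg_of_pos_of_neg hxe (hOe f hf)
    have h2 := mul_nonpos_of_nonneg_of_nonpos hb.le (hxf f (Finset.mem_erase.2 ⟨hne, hf⟩))
    linarith
  have hzz : form z z < 0 := by
    simp only [hz, form_add_left, form_smul_left, form_add_right, form_smul_right, hO.2.1, hx.2.1,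
      form_comm x O]
    have h1 := mul_pos hxe hb
    have h2 : form x e * -form O e * form O x < 0 := mul_neg_of_pos_of_neg h1 (by linarith)
    nlinarith [mul_pos hxe hxe, mul_pos hb hb]
  have hz0 : 0 < z 0 := by
    simp only [hz, Pi.add_apply, Pi.smul_apply, smul_eq_mul]
    exact add_pos (mul_pos hxe hO.2.2) (mul_pos hb hx.2.2)
  obtain ⟨r, hr, -, hrs⟩ := exists_smul_mem_space hzz hz0
  have hcase : ∀ f ∈ S, form z f ≤ 0 := fun f hf => by
    rcases eq_or_ne f e with rfl | hne
    · exact hze.le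
    · exact (hzf f hf hne).le
  refine ⟨r • z, H.mem_iff.2 ⟨⟨W.smul_mem _ (W.add_mem (W.smul_mem _ hO.1) (W.smul_mem _ hx.1)),
    hrs⟩, fun f hf => ?_⟩, ?_⟩
  · rw [form_smul_left]
    exact mul_nonpos_of_nonneg_of_nonpos hr.le (hcase f hf)
  · ext f
    rw [mem_active, Finset.mem_singleton, form_smul_left, mul_eq_zero, or_iff_right hr.ne']
    constructor
    · rintro ⟨hf, h0⟩
      by_contra hne
      exact (hzf f hf hne).ne h0
    · rintro rfl
      exact ⟨he, hze⟩

/-- `Real.arccos` takes the values 0 and π outside (-1, 1), and neither equals π/k with k ≥ 2, so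
the product of the normals is in the range where the arccosine can be inverted. -/
lemma eq_neg_cos_of_dihedralAngle {u v : Minkowski n} {k : ℕ} (hk : 2 ≤ k)
    (h : dihedralAngle u v = Real.pi / k) : form u v = -Real.cos (Real.pi / k) := by
  have hk' : (2 : ℝ) ≤ k := by exact_mod_cast hk
  have hpi := Real.pi_pos
  have h1 : 0 < Real.pi / k := by positivity
  have h2 : Real.pi / k < Real.pi := div_lt_self hpi (by linarith)
  unfold dihedralAngle at h
  have h3 : -form u v < 1 := by
    by_contra! hc
    rw [Real.arccos_of_one_le hc] at h
    linarith
  have h4 : -1 < -form u v := by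
    by_contra! hc
    rw [Real.arccos_of_le_neg_one hc] at h
    linarith
  rw [← h, Real.cos_arccos h4.le h3.le, neg_neg]

lemma cos_pi_div_nonneg {k : ℕ} (hk : 2 ≤ k) : 0 ≤ Real.cos (Real.pi / k) := by
  have hk' : (2 : ℝ) ≤ k := by exact_mod_cast hk
  have hpi := Real.pi_pos
  refine Real.cos_nonneg_of_mem_Icc ⟨by have : 0 ≤ Real.pi / k := by positivity
                                        linarith, ?_⟩
  gcongr

theorem IsCoxeterPolytope.exists_presentation {W : Submodule ℝ (Minkowski n)}
    {P : Set (Minkowski n)} (hP : IsCoxeterPolytope W P) : ∃ S, IsCoxeterPresentation W P S := by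
  obtain ⟨S, H, hfp⟩ := hP.toIsConvexPolytope.exists_presentation
  have hangle : ∀ u ∈ S, ∀ v ∈ S, u ≠ v → (∃ x ∈ plane W, form x u = 0 ∧ form x v = 0) →
      ∃ k : ℕ, 2 ≤ k ∧ form u v = -Real.cos (Real.pi / k) := by
    intro u hu v hv huv hx
    obtain ⟨x, hxP, hxu⟩ := hfp u hu
    obtain ⟨y, hyP, hyv⟩ := hfp v hv
    have hne : cut P {u} ≠ cut P {v} := by
      intro h
      have h1 : x ∈ cut P {u} := ⟨hxP, fun e he => by
        rw [← hxu] at he; exact (mem_active.1 he).2⟩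
      rw [h] at h1
      have h2 : v ∈ active S x := mem_active.2 ⟨hv, h1.2 v (Finset.mem_singleton_self v)⟩
      rw [hxu, Finset.mem_singleton] at h2
      exact huv h2.symm
    obtain ⟨k, hk, hk'⟩ := hP.angles (cut P {u}) (cut P {v}) u v (H.isFacet_cut_singleton hxP hxu)
      (H.isFacet_cut_singleton hyP hyv) hne (H.isOuterNormal hu) (H.isOuterNormal hv) hx
    exact ⟨k, hk, eq_neg_cos_of_dihedralAngle hk hk'⟩
  refine ⟨S, H, hfp, fun u hu v hv huv => ?_, hangle⟩
  by_contra! hc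
  -- A positive product below 1 makes the hyperplanes meet, and the angle condition contradicts the
  -- sign. A product at least 1 makes `v - u` causal, although it has opposite signs at points
  -- interior to the two facets.
  rcases lt_or_ge (form u v) 1 with h1 | h1
  · obtain ⟨O, hO, -⟩ := H.interior
    obtain ⟨a, b, r, -, -, hm, h2, h3⟩ := exists_meet hO (H.mem u hu) (H.mem v hv) (H.unit u hu)
      (H.unit v hv) (by linarith) h1
    obtain ⟨k, hk, hk'⟩ := hangle u hu v hv huv ⟨_, hm, h2, h3⟩
    have := cos_pi_div_nonneg hk
    linarith
  · obtain ⟨x, hxP, hxu⟩ := hfp u hu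
    obtain ⟨y, hyP, hyv⟩ := hfp v hv
    have key : ∀ {x a b : Minkowski n}, x ∈ P → active S x = {a} → b ∈ S → b ≠ a →
        form x (b - a) < 0 := by
      intro x a b hx hxa hb hba
      have h2 : a ∈ active S x := by rw [hxa]; exact Finset.mem_singleton_self a
      rw [form_sub_right, (mem_active.1 h2).2, sub_zero]
      refine lt_of_le_of_ne ((H.mem_iff.1 hx).2 b hb) fun h => ?_
      have h3 : b ∈ active S x := mem_active.2 ⟨hb, h⟩
      rw [hxa, Finset.mem_singleton] at h3
      exact hba h3
    refine causal_sign (w := v - u) (H.mem_space hxP) (H.mem_space hyP) ?_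
      (key hxP hxu hv huv.symm) ?_
    · simp only [form_sub_left, form_sub_right, H.unit u hu, H.unit v hv, form_comm v u]
      linarith
    · have := key hyP hyv hu huv
      rw [form_sub_right] at this ⊢
      linarith

namespace IsCoxeterPresentation

variable {W : Submodule ℝ (Minkowski n)} {P : Set (Minkowski n)} {S : Finset (Minkowski n)}

/-- Vectors with pairwise nonpositive products in a positive definite space (the complement of `x`),
all strictly on one side of a hyperplane (tested by `O`), are independent. This is simplicity of the
polytope. -/
lemma linearIndependent_active (H : IsCoxeterPresentation W P S) {x : Minkowski n} (hx : x ∈ P) :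
    LinearIndependent ℝ (fun e : active S x => (e : Minkowski n)) := by
  obtain ⟨O, hO, hOe⟩ := H.interior
  let M : Submodule ℝ (Minkowski n) := LinearMap.ker (bilin n x)
  have hM : ∀ e : active S x, (e : Minkowski n) ∈ M := fun e => (mem_active.1 e.2).2
  have hli : LinearIndependent ℝ (fun e : active S x => (⟨e, hM e⟩ : M)) := by
    refine LinearMap.BilinForm.linearIndependent_of_pairwise_le_zero ((bilin n).restrict M) ?_
      (-(bilin n O ∘ₗ M.subtype)) _ ?_ ?_
    · intro w hw
      have hw0 : (w : Minkowski n) ≠ 0 := fun h => hw (Subtype.ext h)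
      exact form_self_pos (H.timelike hx) w.2 hw0
    · intro e
      have := hOe e (mem_active.1 e.2).1
      simpa using this
    · intro e f hef
      exact H.nonpos e (mem_active.1 e.2).1 f (mem_active.1 f.2).1 fun h => hef (Subtype.ext h)
  exact hli.map' M.subtype (Submodule.ker_subtype M)

/-- Every subset of an active set is an active set. -/
lemma exists_active_eq (H : IsCoxeterPresentation W P S) {x : Minkowski n} (hx : x ∈ P)
    {K : Finset (Minkowski n)} (hK : K ⊆ active S x) : ∃ y ∈ P, active S y = K := by
  -- By independence some direction is tangent to the facets in `K` and strictly inward for the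
  -- other active ones.
  obtain ⟨w, hw, hwe⟩ := exists_mem_span_form_eq (H.timelike hx)
    (fun e he => (mem_active.1 he).2) (H.linearIndependent_active hx)
    (fun e => if e ∈ K then 0 else -1)
  have hwW : w ∈ W := Submodule.span_le.2 (fun e he => H.mem e (mem_active.1 he).1) hw
  obtain ⟨s, r, -, -, h1, h2⟩ := H.step hx hwW fun e he => by
    rw [hwe e he]; split_ifs <;> norm_num
  refine ⟨_, h1, ?_⟩
  rw [h2]
  ext e
  rw [Finset.mem_filter]
  constructor
  · rintro ⟨h3, h4⟩
    rw [hwe e h3] at h4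
    by_contra h5
    rw [if_neg h5] at h4
    norm_num at h4
  · intro h3
    exact ⟨hK h3, by rw [hwe e (hK h3), if_pos h3]⟩

lemma finrank_perp_active (H : IsCoxeterPresentation W P S) {x : Minkowski n} (hx : x ∈ P) :
    Module.finrank ℝ (perp W (active S x)) + (active S x).card = Module.finrank ℝ W ∧
      1 ≤ Module.finrank ℝ (perp W (active S x)) :=
  H.finrank_perp hx (Finset.Subset.refl _) (H.linearIndependent_active hx)

lemma isFacet_iff (H : IsCoxeterPresentation W P S) {F : Set (Minkowski n)} :
    IsFacet P F ↔ ∃ e ∈ S, F = cut P {e} := by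
  constructor
  · rintro ⟨hF, k, h1, h2⟩
    obtain ⟨x, hx, rfl⟩ := H.face_eq_cut hF
    rw [HasDim, H.span_eq] at h1
    rw [HasDim, H.span_cut hx.1] at h2
    have := (H.finrank_perp_active hx.1).1
    obtain ⟨e, he⟩ := Finset.card_eq_one.1 (by omega : (active S x).card = 1)
    refine ⟨e, ?_, by rw [he]⟩
    exact (mem_active.1 (he ▸ Finset.mem_singleton_self e : e ∈ active S x)).1
  · rintro ⟨e, he, rfl⟩
    obtain ⟨x, hx, hxe⟩ := H.facet_point e he
    exact H.isFacet_cut_singleton hx hxe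

end IsCoxeterPresentation

/-! ### Compactness, edges and their endpoints. -/

lemma exists_orthonormal_direction {M : Submodule ℝ (Minkowski n)} {x : Minkowski n}
    (hx : x ∈ space n) (hxM : x ∈ M) (hM : 2 ≤ Module.finrank ℝ M) :
    ∃ y ∈ M, form x y = 0 ∧ form y y = 1 := by
  have hnle : ¬ M ≤ Submodule.span ℝ {x} := fun h => by
    have h1 := Submodule.finrank_mono h
    have h2 := finrank_span_le_card (R := ℝ) ({x} : Set (Minkowski n))
    simp only [Set.toFinset_singleton, Finset.card_singleton] at h2
    omega
  obtain ⟨w, hw, hwx⟩ := SetLike.not_le_iff_exists.1 hnle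
  set y := w + form x w • x with hy
  have hxy : form x y = 0 := by rw [hy, form_add_right, form_smul_right, hx.1]; ring
  have hy0 : y ≠ 0 := fun h => hwx <| by
    rw [eq_neg_of_add_eq_zero_left h, ← neg_smul]
    exact Submodule.smul_mem _ _ (Submodule.mem_span_singleton_self x)
  have hpos := form_self_pos (by rw [hx.1]; norm_num) hxy hy0
  refine ⟨(√(form y y))⁻¹ • y, M.smul_mem _ (M.add_mem hw (M.smul_mem _ hxM)), ?_, ?_⟩
  · rw [form_smul_right, hxy, mul_zero]
  · rw [form_smul_left, form_smul_right, ← mul_assoc, ← sq, inv_pow, Real.sq_sqrt hpos.le,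
      inv_mul_cancel₀ hpos.ne']

lemma mem_span_pair_of_finrank_two {M : Submodule ℝ (Minkowski n)} {x y z : Minkowski n}
    (hx : x ∈ space n) (hxM : x ∈ M) (hyM : y ∈ M) (hxy : form x y = 0) (hyy : form y y = 1)
    (hM : Module.finrank ℝ M = 2) (hz : z ∈ M) : ∃ a b : ℝ, z = a • x + b • y := by
  have hli : LinearIndependent ℝ ![x, y] := by
    rw [LinearIndependent.pair_iff]
    intro s t h
    have h1 : form x (s • x + t • y) = 0 := by rw [h, form_zero_right]
    have h2 : form y (s • x + t • y) = 0 := by rw [h, form_zero_right]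
    simp only [form_add_right, form_smul_right, hx.1, hxy, form_comm y x, hyy] at h1 h2
    constructor <;> linarith
  have hle : Submodule.span ℝ (Set.range ![x, y]) ≤ M := by
    rw [Submodule.span_le]
    rintro _ ⟨i, rfl⟩
    fin_cases i
    · exact hxM
    · exact hyM
  have heq := Submodule.eq_of_le_of_finrank_eq hle (by rw [finrank_span_eq_card hli, hM]; rfl)
  rw [← heq] at hz
  simp only [Matrix.range_cons, Matrix.range_empty, Set.union_empty, Set.singleton_union] at hz
  obtain ⟨a, b, h⟩ := Submodule.mem_span_pair.1 hz
  exact ⟨a, b, h.symm⟩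

namespace IsPresentation

variable {W : Submodule ℝ (Minkowski n)} {P : Set (Minkowski n)} {S : Finset (Minkowski n)}

/-- A geodesic ray leaves a compact polytope. -/
lemma exists_leaving (H : IsPresentation W P S) (hc : IsCompact P) {x y : Minkowski n}
    (hx : x ∈ space n) (hxW : x ∈ W) (hy : y ∈ W) (hxy : form x y = 0) (hyy : form y y = 1) :
    ∃ τ : ℝ, 0 < τ ∧ τ < 1 ∧ ∃ e ∈ S, 0 < form (x + τ • y) e := by
  obtain ⟨C, hC⟩ := hc.exists_bound_of_continuousOn (f := fun z => form z x)
    (continuous_form continuous_id continuous_const).continuousOn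
  -- As τ tends to 1 the ray nears the light cone. For τ = 1 - q the normalizing factor r has r²(2q
  -- - q²) = 1, and this q makes r exceed the bound C.
  have hq : 0 < (2 * C ^ 2 + 3)⁻¹ := by positivity
  have hq1 : (2 * C ^ 2 + 3)⁻¹ < 1 := inv_lt_one_of_one_lt₀ (by nlinarith [sq_nonneg C])
  set q := (2 * C ^ 2 + 3)⁻¹ with hqd
  have hqC : q * (2 * C ^ 2 + 3) = 1 := inv_mul_cancel₀ (by positivity)
  refine ⟨1 - q, by linarith, by linarith, ?_⟩
  by_contra! hle
  set z := x + (1 - q) • y with hz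
  have hxz : form x z = -1 := by rw [hz, form_add_right, form_smul_right, hx.1, hxy]; ring
  have hzz : form z z = -(2 * q - q ^ 2) := by
    simp only [hz, form_add_left, form_smul_left, form_add_right, form_smul_right, hx.1, hxy,
      form_comm y x, hyy]
    ring
  have hneg : form z z < 0 := by rw [hzz]; nlinarith
  obtain ⟨r, hr, hr2, hrs⟩ := exists_smul_mem_space hneg
    (future_of_form_neg hx hneg (by rw [hxz]; norm_num))
  have hmem : r • z ∈ P := H.mem_iff.2 ⟨⟨W.smul_mem _ (W.add_mem hxW (W.smul_mem _ hy)), hrs⟩,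
    fun e he => by
      rw [form_smul_left]
      exact mul_nonpos_of_nonneg_of_nonpos hr.le (hle e he)⟩
  have hb := hC _ hmem
  rw [form_smul_left, form_comm z x, hxz, Real.norm_eq_abs, mul_neg_one, abs_neg,
    abs_of_pos hr] at hb
  rw [hzz, neg_neg] at hr2
  have h1 : r ^ 2 ≤ C ^ 2 := by gcongr
  nlinarith [mul_le_mul_of_nonneg_right h1 hq.le, mul_nonneg (sq_nonneg r) (sq_nonneg q)]

/-- Moving inside a face of a compact polytope until a new facet is met. -/
lemma exists_exit (H : IsPresentation W P S) (hc : IsCompact P) {x y : Minkowski n}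
    (hx : x ∈ P) (hy : y ∈ perp W (active S x)) (hxy : form x y = 0) (hyy : form y y = 1) :
    ∃ τ r : ℝ, 0 < τ ∧ 0 < r ∧ r • (x + τ • y) ∈ P ∧
      ∃ e ∈ S, 0 < form y e ∧ form (x + τ • y) e = 0 := by
  have hx' := H.mem_iff.1 hx
  obtain ⟨τ', hτ0, hτ1, e', he', hpos⟩ := H.exists_leaving hc hx'.1.2 hx'.1.1 hy.1 hxy hyy
  rw [form_add_left, form_smul_left] at hpos
  have hye' : 0 < form y e' := by
    have := hx'.2 e' he'
    by_contra! h
    nlinarith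
  -- Ratio test: the first hyperplane hit among those being approached.
  obtain ⟨e, he, hmin⟩ := (S.filter fun e => 0 < form y e).exists_min_image
    (fun e => -form x e / form y e) ⟨e', Finset.mem_filter.2 ⟨he', hye'⟩⟩
  obtain ⟨heS, hye⟩ := Finset.mem_filter.1 he
  have hxe : form x e < 0 := by
    refine lt_of_le_of_ne (hx'.2 e heS) fun h => ?_
    exact hye.ne' (hy.2 e (mem_active.2 ⟨heS, h⟩))
  set τ := -form x e / form y e with hτ
  have hτpos : 0 < τ := div_pos (neg_pos.2 hxe) hye
  have hτlt : τ < 1 := by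
    have h1 := hmin e' (Finset.mem_filter.2 ⟨he', hye'⟩)
    have h2 : -form x e' / form y e' < τ' := by rw [div_lt_iff₀ hye']; linarith
    linarith
  have hze : form (x + τ • y) e = 0 := by
    rw [form_add_left, form_smul_left, hτ]; field_simp; ring
  have hxz : form x (x + τ • y) = -1 := by
    rw [form_add_right, form_smul_right, hx'.1.2.1, hxy]; ring
  have hzz : form (x + τ • y) (x + τ • y) < 0 := by
    simp only [form_add_left, form_smul_left, form_add_right, form_smul_right, hx'.1.2.1, hxy,
      form_comm y x, hyy]
    nlinarith
  obtain ⟨r, hr, -, hrs⟩ := exists_smul_mem_space hzz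
    (future_of_form_neg hx'.1.2 hzz (by rw [hxz]; norm_num))
  refine ⟨τ, r, hτpos, hr, H.mem_iff.2 ⟨⟨W.smul_mem _ (W.add_mem hx'.1.1 (W.smul_mem _ hy.1)),
    hrs⟩, fun f hf => ?_⟩, e, heS, hye, hze⟩
  rw [form_smul_left, form_add_left, form_smul_left]
  refine mul_nonpos_of_nonneg_of_nonpos hr.le ?_
  have hxf := hx'.2 f hf
  rcases lt_or_ge 0 (form y f) with h | h
  · have h1 : τ ≤ -form x f / form y f := hmin f (Finset.mem_filter.2 ⟨hf, h⟩)
    rw [le_div_iff₀ h] at h1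
    linarith
  · nlinarith

end IsPresentation

/-- The normals in `A` cut out an edge of `P` with endpoints `V₁`, `V₂`, at which the additional
normals `e₁`, `e₂` are active. -/
structure IsEdge (P : Set (Minkowski n)) (S A : Finset (Minkowski n))
    (V₁ V₂ e₁ e₂ : Minkowski n) : Prop where
  mem_left : V₁ ∈ P
  mem_right : V₂ ∈ P
  active_left : active S V₁ = insert e₁ A
  active_right : active S V₂ = insert e₂ A
  notMem_left : e₁ ∉ A
  notMem_right : e₂ ∉ A
  ne : e₁ ≠ e₂
  segment : ∀ z ∈ cut P A, ∃ a b : ℝ, 0 ≤ a ∧ 0 ≤ b ∧ z = a • V₁ + b • V₂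

lemma IsEdge.swap {P : Set (Minkowski n)} {S A : Finset (Minkowski n)}
    {V₁ V₂ e₁ e₂ : Minkowski n} (h : IsEdge P S A V₁ V₂ e₁ e₂) : IsEdge P S A V₂ V₁ e₂ e₁ where
  mem_left := h.mem_right
  mem_right := h.mem_left
  active_left := h.active_right
  active_right := h.active_left
  notMem_left := h.notMem_right
  notMem_right := h.notMem_left
  ne := h.ne.symm
  segment := fun z hz => by
    obtain ⟨a, b, ha, hb, hab⟩ := h.segment z hz
    exact ⟨b, a, hb, ha, by rw [hab, add_comm]⟩

lemma eq_of_smul_mem_space {x : Minkowski n} {a : ℝ} (hx : x ∈ space n) (ha : 0 ≤ a)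
    (h : a • x ∈ space n) : a = 1 := by
  have := h.1
  rw [form_smul_left, form_smul_right, hx.1] at this
  nlinarith

namespace IsCoxeterPresentation

variable {W : Submodule ℝ (Minkowski n)} {P : Set (Minkowski n)} {S A : Finset (Minkowski n)}
  {V₁ V₂ e₁ e₂ : Minkowski n}

lemma exists_active_ssubset (H : IsCoxeterPresentation W P S) (hc : IsCompact P)
    {x : Minkowski n} (hx : x ∈ P) (hcard : (active S x).card + 2 ≤ Module.finrank ℝ W) :
    ∃ y ∈ P, active S x ⊂ active S y := by
  have hxM : x ∈ perp W (active S x) := ⟨H.mem_W hx, fun e he => (mem_active.1 he).2⟩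
  obtain ⟨y, hy, hxy, hyy⟩ := exists_orthonormal_direction (H.mem_space hx) hxM
    (by have := (H.finrank_perp_active hx).1; omega)
  obtain ⟨τ, r, -, -, hm, e, he, hye, hze⟩ := H.exists_exit hc hx hy hxy hyy
  refine ⟨_, hm, Finset.ssubset_iff_of_subset (fun f hf => mem_active.2 ⟨(mem_active.1 hf).1, ?_⟩)
    |>.2 ⟨e, mem_active.2 ⟨he, ?_⟩, fun h => hye.ne' (hy.2 e h)⟩⟩
  · rw [form_smul_left, form_add_left, form_smul_left, hy.2 f hf, (mem_active.1 hf).2]; ring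
  · rw [form_smul_left, hze, mul_zero]

/-- The face through `x` spans a 2-dimensional subspace, so it lies on a geodesic, which is followed
in both directions until it exits. -/
lemma exists_isEdge (H : IsCoxeterPresentation W P S) (hc : IsCompact P) {x : Minkowski n}
    (hx : x ∈ P) (hA : active S x = A) (hcard : A.card + 2 = Module.finrank ℝ W) :
    ∃ V₁ V₂ e₁ e₂, IsEdge P S A V₁ V₂ e₁ e₂ := by
  subst hA
  have hxM : x ∈ perp W (active S x) := ⟨H.mem_W hx, fun e he => (mem_active.1 he).2⟩
  have hrank : Module.finrank ℝ (perp W (active S x)) = 2 := by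
    have := (H.finrank_perp_active hx).1; omega
  have hxs := H.mem_space hx
  obtain ⟨y, hy, hxy, hyy⟩ := exists_orthonormal_direction hxs hxM hrank.ge
  obtain ⟨τ₁, r₁, hτ₁, hr₁, hm₁, e₁, he₁, hye₁, hz₁⟩ := H.exists_exit hc hx hy hxy hyy
  obtain ⟨τ₂, r₂, hτ₂, hr₂, hm₂, e₂, he₂, hye₂, hz₂⟩ := H.exists_exit hc hx (y := -y)
    (Submodule.neg_mem _ hy) (by rw [form_neg_right, hxy, neg_zero])
    (by rw [form_neg_left, form_neg_right, neg_neg, hyy])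
  have hact : ∀ {τ r : ℝ} {w e : Minkowski n}, w ∈ perp W (active S x) → r • (x + τ • w) ∈ P →
      e ∈ S → 0 < form w e → form (x + τ • w) e = 0 →
      e ∉ active S x ∧ active S (r • (x + τ • w)) = insert e (active S x) := by
    intro τ r w e hw hm he hwe hze
    have hne : e ∉ active S x := fun h => hwe.ne' (hw.2 e h)
    refine ⟨hne, (Finset.eq_of_subset_of_card_le (fun f hf => ?_) ?_).symm⟩
    · rcases Finset.mem_insert.1 hf with rfl | hf
      · exact mem_active.2 ⟨he, by rw [form_smul_left, hze, mul_zero]⟩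
      · refine mem_active.2 ⟨(mem_active.1 hf).1, ?_⟩
        rw [form_smul_left, form_add_left, form_smul_left, hw.2 f hf, (mem_active.1 hf).2]; ring
    -- At most `finrank W - 1` normals are active at a point, so an endpoint gains exactly one.
    · rw [Finset.card_insert_of_notMem hne]
      have := H.finrank_perp_active hm
      omega
  obtain ⟨h1, h2⟩ := hact hy hm₁ he₁ hye₁ hz₁
  obtain ⟨h3, h4⟩ := hact (Submodule.neg_mem _ hy) hm₂ he₂ hye₂ hz₂
  rw [form_neg_left] at hye₂
  refine ⟨_, _, e₁, e₂, hm₁, hm₂, h2, h4, h1, h3, ?_, fun z hz => ?_⟩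
  · rintro rfl
    linarith
  · obtain ⟨a, b, rfl⟩ := mem_span_pair_of_finrank_two hxs hxM hy hxy hyy hrank
      (z := z) ⟨H.mem_W hz.1, hz.2⟩
    have hz' := H.mem_iff.1 hz.1
    have hb1 := hz'.2 e₁ he₁
    have hb2 := hz'.2 e₂ he₂
    simp only [form_add_left, form_smul_left, form_neg_left] at hb1 hb2 hz₁ hz₂
    have hx1 : form x e₁ = -(τ₁ * form y e₁) := by linarith
    have hx2 : form x e₂ = τ₂ * form y e₂ := by linarith
    rw [hx1] at hb1
    rw [hx2] at hb2
    have hb1' : b ≤ a * τ₁ := by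
      by_contra! h
      nlinarith
    have hb2' : 0 ≤ b + a * τ₂ := by
      by_contra! h
      nlinarith
    have hd : 0 < τ₁ + τ₂ := by linarith
    refine ⟨(b + a * τ₂) / (τ₁ + τ₂) / r₁, (a * τ₁ - b) / (τ₁ + τ₂) / r₂, ?_, ?_, ?_⟩
    · positivity
    · have : 0 ≤ a * τ₁ - b := by linarith
      positivity
    · simp only [smul_smul, smul_add, smul_neg, div_mul_cancel₀ _ hr₁.ne',
        div_mul_cancel₀ _ hr₂.ne']
      match_scalars
      · field_simp; ring
      · field_simp; ring

lemma eq_of_cut_singleton_eq (H : IsCoxeterPresentation W P S) {e f : Minkowski n} (he : e ∈ S)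
    (hf : f ∈ S) (h : cut P {e} = cut P {f}) : e = f := by
  obtain ⟨x, hx, hxe⟩ := H.facet_point e he
  have h1 : x ∈ cut P {e} := ⟨hx, fun g hg => by rw [← hxe] at hg; exact (mem_active.1 hg).2⟩
  rw [h] at h1
  have h2 : f ∈ active S x := mem_active.2 ⟨hf, h1.2 f (Finset.mem_singleton_self f)⟩
  rw [hxe, Finset.mem_singleton] at h2
  exact h2.symm

end IsCoxeterPresentation

/-! ### From edges to ridges. -/

namespace IsEdge

variable {W : Submodule ℝ (Minkowski n)} {P : Set (Minkowski n)} {S A : Finset (Minkowski n)}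
  {V₁ V₂ e₁ e₂ : Minkowski n}

lemma left_mem_cut (h : IsEdge P S A V₁ V₂ e₁ e₂) : V₁ ∈ cut P A :=
  ⟨h.mem_left, fun e he => (mem_active.1 (h.active_left ▸ Finset.mem_insert_of_mem he :
    e ∈ active S V₁)).2⟩

lemma right_mem_cut (h : IsEdge P S A V₁ V₂ e₁ e₂) : V₂ ∈ cut P A := h.swap.left_mem_cut

lemma left_mem_normals (h : IsEdge P S A V₁ V₂ e₁ e₂) : e₁ ∈ S ∧ form V₁ e₁ = 0 :=
  mem_active.1 (h.active_left ▸ Finset.mem_insert_self e₁ A : e₁ ∈ active S V₁)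

lemma vertex_left (H : IsPresentation W P S) (h : IsEdge P S A V₁ V₂ e₁ e₂) :
    IsFace (cut P A) {V₁} := by
  obtain ⟨he, h0⟩ := h.left_mem_normals
  refine ⟨Set.singleton_nonempty _, e₁, fun x hx => (H.mem_iff.1 hx.1).2 e₁ he, ?_⟩
  ext z
  constructor
  · rintro rfl
    exact ⟨h.left_mem_cut, h0⟩
  · rintro ⟨hz, hz0⟩
    obtain ⟨a, b, ha, hb, rfl⟩ := h.segment z hz
    rw [form_add_left, form_smul_left, form_smul_left, h0, mul_zero, zero_add, mul_eq_zero] at hz0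
    have hb0 : b = 0 := by
      refine hz0.resolve_right fun h2 => ?_
      have h3 : e₁ ∈ active S V₂ := mem_active.2 ⟨he, h2⟩
      rw [h.active_right, Finset.mem_insert] at h3
      exact h3.elim h.ne h.notMem_left
    subst hb0
    rw [zero_smul, add_zero] at hz ⊢
    rw [eq_of_smul_mem_space (H.mem_space h.mem_left) ha (H.mem_space hz.1), one_smul]
    rfl

lemma left_ne_right (h : IsEdge P S A V₁ V₂ e₁ e₂) : V₁ ≠ V₂ := by
  rintro rfl
  have h1 : e₁ ∈ active S V₁ := h.active_left ▸ Finset.mem_insert_self e₁ A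
  rw [h.active_right, Finset.mem_insert] at h1
  exact h1.elim h.ne h.notMem_left

lemma vertex_eq (H : IsPresentation W P S) (h : IsEdge P S A V₁ V₂ e₁ e₂) {z : Minkowski n}
    (hz : IsFace (cut P A) {z}) : z = V₁ ∨ z = V₂ := by
  obtain ⟨-, g, hg, hzg⟩ := hz
  have hiff : ∀ y, y = z ↔ y ∈ cut P A ∧ form y g = 0 := fun y => by
    rw [← Set.mem_singleton_iff, hzg]; rfl
  obtain ⟨hzE, hz0⟩ := (hiff z).1 rfl
  obtain ⟨a, b, ha, hb, hab⟩ := h.segment z hzE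
  have h1 := hg _ h.left_mem_cut
  have h2 := hg _ h.right_mem_cut
  rw [hab, form_add_left, form_smul_left, form_smul_left] at hz0
  rcases ha.eq_or_lt with rfl | ha'
  · right
    rw [zero_smul, zero_add] at hab
    have hm := H.mem_space hzE.1
    rw [hab] at hm
    rw [hab, eq_of_smul_mem_space (H.mem_space h.mem_right) hb hm, one_smul]
  · left
    have h3 : form V₁ g = 0 := by nlinarith
    exact ((hiff V₁).2 ⟨h.left_mem_cut, h3⟩).symm

/-- By simplicity, a facet through an endpoint that does not contain the edge can only have the one
extra normal active there, so each end has a single framing facet. -/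
lemma exists_isRidge (H : IsCoxeterPresentation ⊤ P S) {x : Minkowski n} (hx : x ∈ P)
    (hA : active S x = A) (hcard : A.card = n - 1) (hn : 1 ≤ n)
    (h : IsEdge P S A V₁ V₂ e₁ e₂) :
    ∃ F : Fin (n - 1) → Set (Minkowski n), IsRidge P (cut P A) F ![cut P {e₁}, cut P {e₂}] := by
  have hAS : ∀ e ∈ A, e ∈ S := fun e he => by rw [← hA] at he; exact (mem_active.1 he).1
  have hxA : x ∈ cut P A := ⟨hx, fun e he => by rw [← hA] at he; exact (mem_active.1 he).2⟩
  have hmem : ∀ {z e : Minkowski n}, z ∈ P → (z ∈ cut P {e} ↔ form z e = 0) := fun {z e} hz => by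
    simp [cut, hz]
  have hsub : ∀ e ∈ S, (cut P A ⊆ cut P {e} ↔ e ∈ A) := fun e he => by
    constructor
    · intro hs
      rw [← hA]
      exact mem_active.2 ⟨he, (hmem hx).1 (hs hxA)⟩
    · exact fun hs z hz => (hmem hz.1).2 (hz.2 e hs)
  have hframe : ∀ {V e f : Minkowski n}, V ∈ P → active S V = insert e A → f ∈ S → f ∉ A →
      (V ∈ cut P {f} → f = e) := by
    intro V e f hV hVe hf hfA hVf
    have : f ∈ active S V := mem_active.2 ⟨hf, (hmem hV).1 hVf⟩
    rw [hVe, Finset.mem_insert] at this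
    exact this.resolve_right hfA
  let ι := (A.equivFinOfCardEq hcard).symm
  refine ⟨fun i => cut P {(ι i : Minkowski n)}, ?_, ?_, ?_, ?_, ?_, ?_⟩
  · rw [← hA]
    exact H.cut_isFace hx (Finset.Subset.refl _)
  · rw [← hA, HasDim, H.span_cut hx]
    have := (H.finrank_perp_active hx).1
    rw [hA, hcard, finrank_top, Module.finrank_fintype_fun_eq_card, Fintype.card_fin] at this
    rw [hA]
    omega
  · intro i j hij
    exact ι.injective (Subtype.ext
      (H.eq_of_cut_singleton_eq (hAS _ (ι i).2) (hAS _ (ι j).2) hij))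
  · ext G
    constructor
    · rintro ⟨i, rfl⟩
      exact ⟨H.isFacet_iff.2 ⟨_, hAS _ (ι i).2, rfl⟩, (hsub _ (hAS _ (ι i).2)).2 (ι i).2⟩
    · rintro ⟨hG, hEG⟩
      obtain ⟨e, he, rfl⟩ := H.isFacet_iff.1 hG
      exact ⟨ι.symm ⟨e, (hsub e he).1 hEG⟩, by simp⟩
  · have hne : cut P {e₁} ≠ cut P {e₂} := fun h1 => h.ne
      (H.eq_of_cut_singleton_eq h.left_mem_normals.1 h.swap.left_mem_normals.1 h1)
    intro i j hij
    fin_cases i <;> fin_cases j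
    · rfl
    · exact absurd hij hne
    · exact absurd hij.symm hne
    · rfl
  · have hG : ∀ {V₁ V₂ e₁ e₂ : Minkowski n}, IsEdge P S A V₁ V₂ e₁ e₂ →
        IsFraming P (cut P A) (cut P {e₁}) := fun {V₁ V₂ e₁ e₂} h =>
      ⟨H.isFacet_iff.2 ⟨_, h.left_mem_normals.1, rfl⟩,
        fun hs => h.notMem_left ((hsub _ h.left_mem_normals.1).1 hs),
        V₁, h.vertex_left H.toIsPresentation, (hmem h.mem_left).2 h.left_mem_normals.2⟩
    ext G
    constructor
    · rintro ⟨i, rfl⟩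
      fin_cases i
      · exact hG h
      · exact hG h.swap
    · rintro ⟨hGf, hEG, v, hv, hvG⟩
      obtain ⟨e, he, rfl⟩ := H.isFacet_iff.1 hGf
      have heA : e ∉ A := fun h' => hEG ((hsub e he).2 h')
      rcases h.vertex_eq H.toIsPresentation hv with rfl | rfl
      · exact ⟨0, by rw [hframe h.mem_left h.active_left he heA hvG]; rfl⟩
      · exact ⟨1, by rw [hframe h.mem_right h.active_right he heA hvG]; rfl⟩

end IsEdge

/-! ### The scalar inequality at a vertex. -/

/-- The properties of the numbers `cos (π / k)`, `k ≥ 2`, that the width estimate uses. -/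
structure IsCoxeterCosine (c : ℝ) : Prop where
  nonneg : 0 ≤ c
  lt_one : c < 1
  eq_zero_or : c = 0 ∨ 1 / 2 ≤ c
  le_of_sq_lt : c ^ 2 < 3 / 4 → c ≤ (1 + √5) / 4

/-- The cosine increases with k: k = 2 gives 0, k = 3 gives 1/2, and a square below cos²(π/6) = 3/4
leaves k ≤ 5, where cos(π/5) = (1 + √5)/4. -/
lemma isCoxeterCosine {k : ℕ} (hk : 2 ≤ k) : IsCoxeterCosine (Real.cos (Real.pi / k)) := by
  have hk' : (2 : ℝ) ≤ k := by exact_mod_cast hk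
  have hpi := Real.pi_pos
  have hpos : 0 < Real.pi / k := by positivity
  have hlt : Real.pi / k < Real.pi := div_lt_self hpi (by linarith)
  have anti : ∀ {m l : ℕ}, 1 ≤ m → m ≤ l → Real.cos (Real.pi / m) ≤ Real.cos (Real.pi / l) := by
    intro m l hm hml
    have hm' : (1 : ℝ) ≤ m := by exact_mod_cast hm
    have hml' : (m : ℝ) ≤ l := by exact_mod_cast hml
    have hl' : (0 : ℝ) < l := by linarith
    apply Real.cos_le_cos_of_nonneg_of_le_pi (by positivity) (div_le_self hpi.le hm')
    gcongr
  refine ⟨cos_pi_div_nonneg hk, ?_, ?_, fun h => ?_⟩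
  · rw [← Real.cos_zero]
    exact Real.cos_lt_cos_of_nonneg_of_le_pi le_rfl hlt.le hpos
  · rcases hk.eq_or_lt with rfl | h3
    · left
      simp
    · right
      have := anti (m := 3) (by norm_num) h3
      rwa [Nat.cast_ofNat, Real.cos_pi_div_three] at this
  · rcases le_or_gt k 5 with h5 | h6
    · have := anti (l := 5) (by omega) h5
      rwa [Nat.cast_ofNat, Real.cos_pi_div_five] at this
    · have h1 := anti (m := 6) (by norm_num) h6
      rw [Nat.cast_ofNat] at h1
      have h2 : 0 ≤ Real.cos (Real.pi / 6) := by rw [Real.cos_pi_div_six]; positivity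
      have := Real.sq_cos_pi_div_six
      nlinarith

/-- With a = √(1 - p²), `h₁` gives z + xp ≤ ay, and q ≤ a ≤ 1, so the left side is at most (2y)².
Exchanging the roles of x and y gives (2x)², and averaging gives 2D. -/
lemma vertex_bound_zero_left {p q x y z D : ℝ} (hp0 : 0 ≤ p) (hq0 : 0 ≤ q)
    (hpq : p ^ 2 + q ^ 2 < 1) (hx : 0 < x) (hy : 0 < y) (hz : 0 < z)
    (hD : x ^ 2 + y ^ 2 = D) (h₁ : x ^ 2 + z ^ 2 + 2 * p * x * z ≤ D * (1 - p ^ 2))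
    (h₂ : y ^ 2 + z ^ 2 + 2 * q * y * z ≤ D * (1 - q ^ 2)) :
    (z + (x * p + y * q)) ^ 2 ≤ 2 * D := by
  have key : ∀ {p q x y : ℝ}, 0 ≤ p → 0 ≤ q → p ^ 2 + q ^ 2 < 1 → 0 < x → 0 < y →
      x ^ 2 + y ^ 2 = D → x ^ 2 + z ^ 2 + 2 * p * x * z ≤ D * (1 - p ^ 2) →
      (z + (x * p + y * q)) ^ 2 ≤ 4 * y ^ 2 := by
    intro p q x y hp0 hq0 hpq hx hy hD h₁
    have ha : 0 ≤ 1 - p ^ 2 := by nlinarith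
    have hs := Real.sq_sqrt ha
    have hs0 := Real.sqrt_nonneg (1 - p ^ 2)
    set a := √(1 - p ^ 2)
    have e1 : z + x * p ≤ a * y := by
      apply abs_le_of_sq_le_sq' _ (by positivity) |>.2
      rw [mul_pow, hs]; nlinarith
    have e2 : q ≤ a := abs_le_of_sq_le_sq' (by rw [hs]; linarith) hs0 |>.2
    have e3 : a ≤ 1 := abs_le_of_sq_le_sq' (by rw [hs]; nlinarith) (by norm_num) |>.2
    have e4 : z + (x * p + y * q) ≤ 2 * y := by nlinarith
    have e5 : 0 ≤ z + (x * p + y * q) := by positivity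
    nlinarith
  have k1 := key hp0 hq0 hpq hx hy hD h₁
  have k2 := key hq0 hp0 (by linarith) hy hx (by linarith) h₂
  rw [add_comm (y * q)] at k2
  linarith

/-- Either the left side is at most its value at κ = 1, which is bounded by `h`, or the failure of
that comparison bounds it by D + z² ≤ 2D. -/
lemma interpolation_bound {κ w z D : ℝ} (hκ0 : 0 ≤ κ) (hκ1 : κ ≤ 1) (hz : 0 ≤ z) (hzw : z ≤ w)
    (hwD : w ^ 2 ≤ D) (h : (z + w) ^ 2 ≤ 2.82 * D) :
    (1 - κ ^ 2) / 2 * D + (z + κ * w) ^ 2 ≤ 2.87 * D := by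
  have hD : 0 ≤ D := (sq_nonneg w).trans hwD
  have hz2 : z ^ 2 ≤ w ^ 2 := by gcongr
  rcases le_or_gt ((1 + κ) / 2 * D) (w * (2 * z + (1 + κ) * w)) with h' | h'
  · have := mul_le_mul_of_nonneg_left h' (by linarith : 0 ≤ 1 - κ)
    linarith
  · have h1 := mul_le_mul_of_nonneg_left h'.le hκ0
    have h2 := mul_nonneg hκ0 (sq_nonneg w)
    have h3 := mul_le_mul_of_nonneg_right hκ1 hD
    linarith

/-- Write c = cos θ, s = sin θ. The hypothesis `hzw` reads z ≤ Cw + Tx with C, T the cosine and sine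
of θ + π/6. Cauchy–Schwarz gives (2 + 2C)D, and c ≤ cos(π/5) makes C at most cos 66° < 0.41. -/
lemma rotated_bound {c s x w z D : ℝ} (hc : 0 ≤ c) (hc5 : c ≤ (1 + √5) / 4) (hs0 : 0 < s)
    (hcs : c ^ 2 = 1 - s ^ 2) (hw : 0 ≤ w) (hz : 0 ≤ z) (hwD : w ^ 2 + x ^ 2 = D)
    (hzw : z + (s * w - c * x) / 2 ≤ √3 / 2 * (s * x + c * w)) : (z + w) ^ 2 ≤ 2.82 * D := by
  have ha : √5 ≤ 2.2361 := Real.sqrt_le_iff.2 ⟨by norm_num, by norm_num⟩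
  have hb : √3 ≤ 1.7321 := Real.sqrt_le_iff.2 ⟨by norm_num, by norm_num⟩
  have h3 := Real.sq_sqrt (show (0 : ℝ) ≤ 3 by norm_num)
  have hcc : c ≤ 0.809025 := by linarith
  have hss : 0.5877 ≤ s := by
    by_contra! h
    have h1 : s ^ 2 ≤ 0.5877 ^ 2 := by gcongr
    have h2 : c ^ 2 ≤ 0.809025 ^ 2 := by gcongr
    norm_num at h1 h2
    linarith
  obtain ⟨C, hC⟩ : ∃ C, C = (√3 * c - s) / 2 := ⟨_, rfl⟩
  obtain ⟨T, hT⟩ : ∃ T, T = (√3 * s + c) / 2 := ⟨_, rfl⟩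
  have hC1 : C ≤ 0.41 := by
    have : √3 * c ≤ 1.7321 * 0.809025 := by gcongr
    rw [hC]
    norm_num at this ⊢
    linarith
  have hCT : C ^ 2 + T ^ 2 = 1 := by
    rw [hC, hT]
    linear_combination (√3 ^ 2 + 1) / 4 * hcs + h3 / 4
  have hzC : z + w ≤ (1 + C) * w + T * x := by
    have e : (1 + C) * w + T * x = w + √3 / 2 * (s * x + c * w) - (s * w - c * x) / 2 := by
      rw [hC, hT]; ring
    linarith
  have e1 : (z + w) ^ 2 ≤ ((1 + C) * w + T * x) ^ 2 := by gcongr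
  have e2 : ((1 + C) * w + T * x) ^ 2 ≤ ((1 + C) ^ 2 + T ^ 2) * (w ^ 2 + x ^ 2) := by
    linarith [sq_nonneg ((1 + C) * x - T * w)]
  have e3 : (1 + C) ^ 2 + T ^ 2 = 2 + 2 * C := by linear_combination hCT
  rw [e3, hwD] at e2
  have hD : 0 ≤ D := by rw [← hwD]; positivity
  have e4 : (2 + 2 * C) * D ≤ 2.82 * D := by gcongr; linarith
  linarith

lemma vertex_bound_zero_mid {c q x y z D : ℝ} (hc : 0 ≤ c) (hcq : c ^ 2 + q ^ 2 < 1)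
    (hc5 : c ≤ (1 + √5) / 4) (hq : 1 / 2 ≤ q) (hx : 0 < x) (hy : 0 < y) (hz : 0 < z)
    (hD : x ^ 2 + y ^ 2 + 2 * c * x * y = D * (1 - c ^ 2)) (h₁ : x ^ 2 + z ^ 2 ≤ D)
    (h₂ : y ^ 2 + z ^ 2 + 2 * q * y * z ≤ D * (1 - q ^ 2)) :
    (1 - c ^ 2 - q ^ 2) / (1 - c ^ 2) / 2 * D + (z + (x * (c * q) + y * q) / (1 - c ^ 2)) ^ 2 ≤
      2.87 * D := by
  have hc2 : 0 < 1 - c ^ 2 := by nlinarith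
  have hs := Real.sq_sqrt hc2.le
  have hs0 := Real.sqrt_pos.2 hc2
  have h3 := Real.sq_sqrt (show (0 : ℝ) ≤ 3 by norm_num)
  set s := √(1 - c ^ 2)
  rw [← hs] at hD ⊢
  have hc2' : c ^ 2 = 1 - s ^ 2 := by linarith
  have hD0 : 0 < D := by nlinarith
  -- The pairs (w, x) and (s x + c w, y) are orthogonal coordinates of one vector of squared length
  -- D, so `h₁` becomes z ≤ w and `h₂` becomes the hypothesis of `rotated_bound`.
  obtain ⟨κ, hκ⟩ : ∃ κ, q = κ * s := ⟨q / s, by field_simp⟩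
  obtain ⟨w, hw⟩ : ∃ w, y = s * w - c * x := ⟨(y + c * x) / s, by field_simp; ring⟩
  have hw0 : 0 < w := by
    by_contra! h
    nlinarith [mul_nonneg hc hx.le]
  have hκ0 : 0 < κ := by
    by_contra! h
    nlinarith
  have hκ1 : κ < 1 := by
    by_contra! h
    have := le_mul_of_one_le_left (sq_nonneg s) (one_le_pow₀ h (n := 2))
    rw [hκ, mul_pow] at hcq
    linarith
  have hwD : w ^ 2 + x ^ 2 = D := by
    have : s ^ 2 * (w ^ 2 + x ^ 2) = s ^ 2 * D := by
      rw [mul_comm (s ^ 2) D, ← hD, hw]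
      linear_combination x ^ 2 * hc2'
    exact mul_left_cancel₀ (by positivity) this
  have hzw : z ≤ w := abs_le_of_sq_le_sq' (by linarith) hw0.le |>.2
  have hv0 : 0 ≤ s * x + c * w := by positivity
  have hv : (s * x + c * w) ^ 2 + y ^ 2 = D := by
    rw [hw, ← hwD]
    linear_combination (w ^ 2 + x ^ 2) * hc2'
  have hzv : z + y / 2 ≤ √3 / 2 * (s * x + c * w) := by
    apply abs_le_of_sq_le_sq' _ (by positivity) |>.2
    have : (2 * q - 1) * (y * z) ≥ 0 := mul_nonneg (by linarith) (by positivity)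
    have : D * (1 - q ^ 2) ≤ D * (3 / 4) := by gcongr; nlinarith
    rw [mul_pow, div_pow, h3]
    nlinarith
  have hsq : (z + w) ^ 2 ≤ 2.82 * D :=
    rotated_bound hc hc5 hs0 hc2' hw0.le hz.le hwD (by rw [← hw]; exact hzv)
  have e1 : (s ^ 2 - q ^ 2) / s ^ 2 = 1 - κ ^ 2 := by rw [hκ]; field_simp
  have e2 : z + (x * (c * q) + y * q) / s ^ 2 = z + κ * w := by
    rw [hκ, hw]; field_simp; ring
  rw [e1, e2]
  exact interpolation_bound hκ0.le hκ1.le hz.le hzw (by nlinarith [sq_nonneg x]) hsq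

/-- Here x, y, z are the hyperbolic sines of the distances from O to the three facets at the vertex,
`hdet` is positivity of their Gram determinant, and `h₁`, `h₂` are maximality of D. The determinant
forces one of the cosines to vanish, which leaves the cases treated above. -/
lemma vertex_bound {c p q x y z D : ℝ} (hc : IsCoxeterCosine c) (hp : IsCoxeterCosine p)
    (hq : IsCoxeterCosine q) (hdet : 0 < 1 - c ^ 2 - p ^ 2 - q ^ 2 - 2 * c * p * q)
    (hx : 0 < x) (hy : 0 < y) (hz : 0 < z)
    (hD : x ^ 2 + y ^ 2 + 2 * c * x * y = D * (1 - c ^ 2))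
    (h₁ : x ^ 2 + z ^ 2 + 2 * p * x * z ≤ D * (1 - p ^ 2))
    (h₂ : y ^ 2 + z ^ 2 + 2 * q * y * z ≤ D * (1 - q ^ 2)) :
    (1 - c ^ 2 - p ^ 2 - q ^ 2 - 2 * c * p * q) / (1 - c ^ 2) / 2 * D +
      (z + (x * (p + c * q) + y * (q + c * p)) / (1 - c ^ 2)) ^ 2 ≤ 2.87 * D := by
  have hc2 : 0 < 1 - c ^ 2 := by nlinarith [hc.nonneg, hc.lt_one]
  have hD0 : 0 < D := by
    have := mul_nonneg hc.nonneg (mul_pos hx hy).le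
    by_contra! h
    nlinarith
  rcases hc.eq_zero_or with rfl | hc'
  · have := vertex_bound_zero_left hp.nonneg hq.nonneg (by linarith) hx hy hz (D := D)
      (by linarith) h₁ h₂
    norm_num
    nlinarith [sq_nonneg p, sq_nonneg q]
  have key : ∀ {q x y : ℝ}, IsCoxeterCosine q → 0 < 1 - c ^ 2 - q ^ 2 → 0 < x → 0 < y →
      x ^ 2 + y ^ 2 + 2 * c * x * y = D * (1 - c ^ 2) → x ^ 2 + z ^ 2 ≤ D →
      y ^ 2 + z ^ 2 + 2 * q * y * z ≤ D * (1 - q ^ 2) →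
      (1 - c ^ 2 - q ^ 2) / (1 - c ^ 2) / 2 * D +
        (z + (x * (c * q) + y * q) / (1 - c ^ 2)) ^ 2 ≤ 2.87 * D := by
    intro q x y hq hdet hx hy hD h₁ h₂
    rcases hq.eq_zero_or with rfl | hq'
    · have e : (1 - c ^ 2 - 0 ^ 2) / (1 - c ^ 2) = 1 := by
        rw [zero_pow two_ne_zero, sub_zero, div_self hc2.ne']
      rw [e]
      simp only [mul_zero, add_zero, zero_div]
      nlinarith [sq_nonneg x]
    · exact vertex_bound_zero_mid hc.nonneg (by linarith) (hc.le_of_sq_lt (by nlinarith)) hq'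
        hx hy hz hD h₁ h₂
  rcases hp.eq_zero_or with rfl | hp'
  · have := key hq (by linarith) hx hy hD (by linarith) h₂
    simpa using this
  rcases hq.eq_zero_or with rfl | hq'
  · have := key hp (by linarith) hy hx (by linarith) (by linarith) h₁
    simpa [add_comm] using this
  · exfalso
    -- Three cosines at least 1/2 give a determinant at most 1 - 3/4 - 1/4 = 0.
    have h1 : 1 / 2 * (1 / 2) * (1 / 2) ≤ c * p * q := by gcongr
    nlinarith

/-! ### From the scalar inequality to the framing normals. -/

/-- The square of the hyperbolic sine of the distance from `O` to the intersection of the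
hyperplanes orthogonal to the unit vectors `u`, `v`. -/
noncomputable def sinhSqDist (O u v : Minkowski n) : ℝ :=
  (form O u ^ 2 + form O v ^ 2 - 2 * form u v * form O u * form O v) / (1 - form u v ^ 2)

/-- The estimate at one vertex of an outermost edge. -/
lemma exists_projection {O V u₁ u₂ u₃ : Minkowski n} (hV : form V V < 0)
    (h1 : form u₁ u₁ = 1) (h2 : form u₂ u₂ = 1) (h3 : form u₃ u₃ = 1)
    (hV1 : form V u₁ = 0) (hV2 : form V u₂ = 0) (hV3 : form V u₃ = 0)
    (hO1 : form O u₁ < 0) (hO2 : form O u₂ < 0) (hO3 : form O u₃ < 0)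
    (hc : IsCoxeterCosine (-form u₁ u₂)) (hp : IsCoxeterCosine (-form u₁ u₃))
    (hq : IsCoxeterCosine (-form u₂ u₃)) (hm1 : sinhSqDist O u₁ u₃ ≤ sinhSqDist O u₁ u₂)
    (hm2 : sinhSqDist O u₂ u₃ ≤ sinhSqDist O u₁ u₂) :
    ∃ α β : ℝ, 0 ≤ α ∧ 0 ≤ β ∧ form (u₃ + α • u₁ + β • u₂) u₁ = 0 ∧
      form (u₃ + α • u₁ + β • u₂) u₂ = 0 ∧
      form (u₃ + α • u₁ + β • u₂) u₃ / 2 * sinhSqDist O u₁ u₂ +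
        form O (u₃ + α • u₁ + β • u₂) ^ 2 ≤ 2.87 * sinhSqDist O u₁ u₂ := by
  have hc2 : ∀ {a b : Minkowski n}, IsCoxeterCosine (-form a b) → 0 < 1 - form a b ^ 2 :=
    fun h => by nlinarith [h.nonneg, h.lt_one]
  have c2 := hc2 hc
  have p2 := hc2 hp
  have q2 := hc2 hq
  have hD : sinhSqDist O u₁ u₂ * (1 - form u₁ u₂ ^ 2) =
      form O u₁ ^ 2 + form O u₂ ^ 2 - 2 * form u₁ u₂ * form O u₁ * form O u₂ :=
    div_mul_cancel₀ _ c2.ne'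
  have hb1 := (div_le_iff₀ p2).1 hm1
  have hb2 := (div_le_iff₀ q2).1 hm2
  set D := sinhSqDist O u₁ u₂
  have hc0 := hc.nonneg
  have hp0 := hp.nonneg
  have hq0 := hq.nonneg
  set c := -form u₁ u₂ with hcd
  set p := -form u₁ u₃ with hpd
  set q := -form u₂ u₃ with hqd
  have ec : form u₁ u₂ = -c := by rw [hcd, neg_neg]
  have ep : form u₁ u₃ = -p := by rw [hpd, neg_neg]
  have eq : form u₂ u₃ = -q := by rw [hqd, neg_neg]
  rw [ec, neg_sq] at c2 hD
  rw [ep, neg_sq] at hb1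
  rw [eq, neg_sq] at hb2
  have hα : 0 ≤ (p + c * q) / (1 - c ^ 2) := by positivity
  have hβ : 0 ≤ (q + c * p) / (1 - c ^ 2) := by positivity
  -- The coefficients that make `u` orthogonal to `u₁` and `u₂`; its norm is then a quotient of Gram
  -- determinants, positive because `u` is orthogonal to the timelike `V`.
  set α := (p + c * q) / (1 - c ^ 2) with hαd
  set β := (q + c * p) / (1 - c ^ 2) with hβd
  set u := u₃ + α • u₁ + β • u₂ with hu
  have z1 : form u u₁ = 0 := by
    simp only [hu, form_add_left, form_smul_left, h1, form_comm u₃ u₁, form_comm u₂ u₁, ec, ep]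
    rw [hαd, hβd]; field_simp; ring
  have z2 : form u u₂ = 0 := by
    simp only [hu, form_add_left, form_smul_left, h2, form_comm u₃ u₂, ec, eq]
    rw [hαd, hβd]; field_simp; ring
  have z3 : form u u₃ = (1 - c ^ 2 - p ^ 2 - q ^ 2 - 2 * c * p * q) / (1 - c ^ 2) := by
    simp only [hu, form_add_left, form_smul_left, h3, ep, eq]
    rw [hαd, hβd]; field_simp; ring
  have hOu : form O u = form O u₃ + α * form O u₁ + β * form O u₂ := by
    simp only [hu, form_add_right, form_smul_right]
  have hOneg : form O u < 0 := by
    rw [hOu]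
    nlinarith
  have hne : u ≠ 0 := fun h => by rw [h, form_zero_right] at hOneg; exact lt_irrefl _ hOneg
  have hVu : form V u = 0 := by
    simp only [hu, form_add_right, form_smul_right, hV1, hV2, hV3]; ring
  have hpos := form_self_pos hV hVu hne
  have huu : form u u = form u u₃ := by
    conv_lhs => rw [hu, form_add_right, form_add_right, form_smul_right, form_smul_right, ← hu]
    rw [z1, z2]; ring
  rw [huu, z3, lt_div_iff₀ c2, zero_mul] at hpos
  refine ⟨α, β, hα, hβ, z1, z2, ?_⟩
  have := vertex_bound hc hp hq hpos (neg_pos.2 hO1) (neg_pos.2 hO2) (neg_pos.2 hO3) (D := D)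
    (by linarith) (by linarith) (by linarith)
  rw [z3, hOu]
  convert this using 2
  rw [hαd, hβd]
  field_simp
  ring

/-- The estimates at the two vertices bound the product of the framing normals. -/
lemma neg_form_framing_lt {O u₁ u₂ u₃ u₄ : Minkowski n} (hO : O ∈ space n)
    (h1 : form u₁ u₁ = 1) (h2 : form u₂ u₂ = 1)
    (hO1 : form O u₁ < 0) (hO2 : form O u₂ < 0) (hc : IsCoxeterCosine (-form u₁ u₂))
    (h14 : form u₁ u₄ ≤ 0) (h24 : form u₂ u₄ ≤ 0) {α β α' β' : ℝ} (hα : 0 ≤ α) (hβ : 0 ≤ β)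
    (hu1 : form (u₃ + α • u₁ + β • u₂) u₁ = 0) (hu2 : form (u₃ + α • u₁ + β • u₂) u₂ = 0)
    (hu : form (u₃ + α • u₁ + β • u₂) u₃ / 2 * sinhSqDist O u₁ u₂ +
        form O (u₃ + α • u₁ + β • u₂) ^ 2 ≤ 2.87 * sinhSqDist O u₁ u₂)
    (hv1 : form (u₄ + α' • u₁ + β' • u₂) u₁ = 0) (hv2 : form (u₄ + α' • u₁ + β' • u₂) u₂ = 0)
    (hv : form (u₄ + α' • u₁ + β' • u₂) u₄ / 2 * sinhSqDist O u₁ u₂ +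
        form O (u₄ + α' • u₁ + β' • u₂) ^ 2 ≤ 2.87 * sinhSqDist O u₁ u₂) :
    -form u₃ u₄ < 5.75 := by
  have c2 : 0 < 1 - form u₁ u₂ ^ 2 := by nlinarith [hc.nonneg, hc.lt_one]
  have hD : sinhSqDist O u₁ u₂ * (1 - form u₁ u₂ ^ 2) =
      form O u₁ ^ 2 + form O u₂ ^ 2 - 2 * form u₁ u₂ * form O u₁ * form O u₂ :=
    div_mul_cancel₀ _ c2.ne'
  have hDpos : 0 < sinhSqDist O u₁ u₂ := by
    refine div_pos ?_ c2
    nlinarith [mul_pos (neg_pos.2 hO1) (neg_pos.2 hO2), sq_pos_of_neg hO1, hc.nonneg,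
      mul_nonneg hc.nonneg (mul_pos (neg_pos.2 hO1) (neg_pos.2 hO2)).le]
  set D := sinhSqDist O u₁ u₂
  set u := u₃ + α • u₁ + β • u₂ with hud
  set v := u₄ + α' • u₁ + β' • u₂ with hvd
  set g := form u₁ u₂ with hg
  obtain ⟨a, ha⟩ : ∃ a, a * (1 - g ^ 2) = g * form O u₂ - form O u₁ :=
    ⟨_, div_mul_cancel₀ _ c2.ne'⟩
  obtain ⟨b, hb⟩ : ∃ b, b * (1 - g ^ 2) = g * form O u₁ - form O u₂ :=
    ⟨_, div_mul_cancel₀ _ c2.ne'⟩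
  have hN : a * form O u₁ + b * form O u₂ = -D := by
    apply mul_right_cancel₀ c2.ne'
    linear_combination form O u₁ * ha + form O u₂ * hb + hD
  -- The projection of `O` to the complement of `u₁`, `u₂`, with squared norm -(1 + D).
  set O' := O + a • u₁ + b • u₂ with hO'
  have o1 : form O' u₁ = 0 := by
    apply mul_right_cancel₀ c2.ne'
    simp only [hO', form_add_left, form_smul_left, h1, form_comm u₂ u₁, ← hg]
    linear_combination ha + g * hb
  have o2 : form O' u₂ = 0 := by
    apply mul_right_cancel₀ c2.ne'
    simp only [hO', form_add_left, form_smul_left, h2, ← hg]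
    linear_combination g * ha + hb
  have reduce : ∀ {w z : Minkowski n} (s t : ℝ), form w u₁ = 0 → form w u₂ = 0 →
      form w (z + s • u₁ + t • u₂) = form w z := by
    intro w z s t hw1 hw2
    rw [form_add_right, form_add_right, form_smul_right, form_smul_right, hw1, hw2]; ring
  have huu : form u u = form u u₃ := reduce α β hu1 hu2
  have hvv : form v v = form v u₄ := reduce α' β' hv1 hv2
  have huv : form u v ≤ form u₃ u₄ := by
    rw [show form u v = form u u₄ from reduce α' β' hu1 hu2, hud]
    simp only [form_add_left, form_smul_left]
    nlinarith
  have huO : form u O' = form O u := (reduce a b hu1 hu2).trans (form_comm _ _)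
  have hvO : form v O' = form O v := (reduce a b hv1 hv2).trans (form_comm _ _)
  have hOO : form O' O' = -(1 + D) := by
    rw [show form O' O' = form O' O from reduce a b o1 o2, form_comm]
    simp only [hO', form_add_right, form_smul_right, hO.1]
    linear_combination hN
  have hOO' : form O O' = -(1 + D) := by
    rw [← hOO, form_comm]; exact (reduce a b o1 o2).symm
  have hN0 : 0 < 1 + D := by linarith
  obtain ⟨l, hl⟩ : ∃ l, l * (1 + D) = form O u + form O v := ⟨_, div_mul_cancel₀ _ hN0.ne'⟩
  -- This `l` makes the vector orthogonal to `O`, hence of nonnegative norm; this bounds `-2 * form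
  -- u v` from above.
  have hw := form_self_nonneg (z := O) (w := u + v + l • O') (by rw [hO.1]; norm_num)
    (by simp only [form_add_right, form_smul_right, hOO']; linarith)
  simp only [form_add_left, form_add_right, form_smul_left, form_smul_right, hOO, huO, hvO,
    form_comm O' u, form_comm O' v, form_comm v u, huu, hvv] at hw
  have hw' : 0 ≤ form u u₃ + form v u₄ + 2 * form u v + l * (form O u + form O v) := by
    have e : l * (l * (1 + D)) = l * (form O u + form O v) := by rw [hl]
    linarith
  have hl2 : l * (form O u + form O v) * D ≤ (form O u + form O v) ^ 2 := by
    have : (form O u + form O v) ^ 2 = l * (form O u + form O v) * (1 + D) := by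
      rw [← hl]; ring
    have h0 : 0 ≤ l * (form O u + form O v) := by
      rw [← hl]
      linarith [mul_nonneg (sq_nonneg l) hN0.le]
    linarith
  -- By (a + b)² ≤ 2a² + 2b², the two vertex estimates add up to 4 · 2.87 = 11.48.
  have hfin : -2 * form u v * D ≤ 11.48 * D := by
    linarith [mul_nonneg hw' hDpos.le, sq_nonneg (form O u - form O v)]
  have := le_of_mul_le_mul_right hfin hDpos
  linarith

lemma width_le {G : Fin 2 → Set (Minkowski n)} (h0 : G 0 ⊆ space n) (h1 : G 1 ⊆ space n)
    {x y : Minkowski n} (hx : x ∈ G 0) (hy : y ∈ G 1) : width G ≤ -form x y := by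
  have hrho : ∀ {a b : Minkowski n}, a ∈ space n → b ∈ space n → 0 ≤ rho a b :=
    fun ha hb => Real.arcosh_nonneg (by linarith [form_le_neg_one ha hb])
  have hlb : ∀ d ∈ {d : ℝ | ∃ x ∈ G 0, ∃ y ∈ G 1, d = rho x y}, 0 ≤ d := by
    rintro d ⟨a, ha, b, hb, rfl⟩
    exact hrho (h0 ha) (h1 hb)
  have hle : setDist (G 0) (G 1) ≤ rho x y := csInf_le ⟨0, hlb⟩ ⟨x, hx, y, hy, rfl⟩
  have hnn : 0 ≤ setDist (G 0) (G 1) := Real.sInf_nonneg hlb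
  calc width G ≤ Real.cosh (rho x y) := by
        rw [width, Real.cosh_le_cosh, abs_of_nonneg hnn, abs_of_nonneg (hnn.trans hle)]
        exact hle
    _ = -form x y := Real.cosh_arcosh (by linarith [form_le_neg_one (h0 hx) (h1 hy)])

/-! ### Outermost edges and the passage from the face to the polytope. -/

namespace IsCoxeterPresentation

variable {W : Submodule ℝ (Minkowski n)} {P : Set (Minkowski n)} {S : Finset (Minkowski n)}

/-- The common perpendicular of two facets of a compact Coxeter polytope with disjoint hyperplanes
ends on the facets; facets whose hyperplanes meet have a common point. -/
lemma exists_near_points (H : IsCoxeterPresentation W P S) (hc : IsCompact P) {u v : Minkowski n}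
    (hu : u ∈ S) (hv : v ∈ S) (huv : u ≠ v) {B : ℝ} (hB : 1 < B) (ht : -form u v < B) :
    ∃ p ∈ cut P {u}, ∃ q ∈ cut P {v}, -form p q < B := by
  obtain ⟨O, hO, hOS⟩ := H.interior
  have huu := H.unit u hu
  have hvv := H.unit v hv
  have hcut : ∀ {x e : Minkowski n}, x ∈ P → form x e = 0 → x ∈ cut P {e} := fun hx h =>
    ⟨hx, fun f hf => by rw [Finset.mem_singleton.1 hf]; exact h⟩
  have hle := H.nonpos u hu v hv huv
  rcases lt_trichotomy (form u v) (-1) with h | h | h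
  -- Disjoint hyperplanes: the foot of the common perpendicular is a multiple of v - (u,v)u, and
  -- nonpositive products keep it inside `P`.
  · have key : ∀ {u v : Minkowski n}, u ∈ S → v ∈ S → u ≠ v → form u v < -1 →
        ∃ r : ℝ, 0 < r ∧ r ^ 2 * (form u v ^ 2 - 1) = 1 ∧ r • (v - form u v • u) ∈ cut P {u} := by
      intro u v hu hv huv h
      have huu := H.unit u hu
      have hvv := H.unit v hv
      have hz : form (v - form u v • u) (v - form u v • u) = 1 - form u v ^ 2 := by
        simp only [form_sub_left, form_sub_right, form_smul_left, form_smul_right, huu, hvv,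
          form_comm v u]
        ring
      have hzu : form (v - form u v • u) u = 0 := by
        rw [form_sub_left, form_smul_left, huu, form_comm v u]; ring
      have hneg : form (v - form u v • u) (v - form u v • u) < 0 := by rw [hz]; nlinarith
      have hOz : form O (v - form u v • u) < 0 := by
        rw [form_sub_right, form_smul_right]
        nlinarith [hOS u hu, hOS v hv]
      obtain ⟨r, hr, hr2, hrs⟩ := exists_smul_mem_space hneg (future_of_form_neg hO.2 hneg hOz)
      refine ⟨r, hr, by rw [hz] at hr2; linarith, hcut (H.mem_iff.2 ⟨⟨W.smul_mem _
        (W.sub_mem (H.mem v hv) (W.smul_mem _ (H.mem u hu))), hrs⟩, fun e he => ?_⟩) ?_⟩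
      · rw [form_smul_left]
        refine mul_nonpos_of_nonneg_of_nonpos hr.le ?_
        rcases eq_or_ne e u with rfl | heu
        · exact hzu.le
        · rw [form_sub_left, form_smul_left]
          rcases eq_or_ne e v with rfl | hev
          · rw [hvv]; nlinarith
          · have h1 := H.nonpos v hv e he hev.symm
            have h2 := H.nonpos u hu e he heu.symm
            nlinarith
      · rw [form_smul_left, hzu, mul_zero]
    obtain ⟨r, hr, hr2, hp⟩ := key hu hv huv h
    obtain ⟨r', hr', hr2', hq⟩ := key hv hu huv.symm (by rwa [form_comm])
    rw [form_comm v u] at hr2' hq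
    have hrr : r' = r := by
      have hne : form u v ^ 2 - 1 ≠ 0 := by
        intro h0
        rw [h0] at hr2
        norm_num at hr2
      exact (sq_eq_sq₀ hr'.le hr.le).1 (mul_right_cancel₀ hne (hr2'.trans hr2.symm))
    rw [hrr] at hq
    refine ⟨_, hp, _, hq, ?_⟩
    have : form (r • (v - form u v • u)) (r • (u - form u v • v)) = form u v := by
      simp only [form_sub_left, form_sub_right, form_smul_left, form_smul_right, huu, hvv,
        form_comm v u]
      linear_combination form u v * hr2
    rwa [this]
  -- Tangent hyperplanes: `u + v` is lightlike, and the ray from `O` towards this ideal point never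
  -- leaves `P`, against compactness.
  · exfalso
    set m := u + v with hm
    set μ := -form O m with hμ
    have hμ0 : 0 < μ := by
      rw [hμ, hm, form_add_right]
      linarith [hOS u hu, hOS v hv]
    have hmm : form m m = 0 := by
      simp only [hm, form_add_left, form_add_right, huu, hvv, form_comm v u, h]; norm_num
    have hmO : form m O = -μ := by rw [form_comm, hμ, neg_neg]
    have hOm : form O m = -μ := by rw [hμ, neg_neg]
    obtain ⟨τ, h0, h1, e, he, hpos⟩ := H.exists_leaving hc (y := μ⁻¹ • m - O) hO.2 hO.1
      (W.sub_mem (W.smul_mem _ (W.add_mem (H.mem u hu) (H.mem v hv))) hO.1)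
      (by rw [form_sub_right, form_smul_right, hOm, hO.2.1]; field_simp; ring)
      (by simp only [form_sub_left, form_sub_right, form_smul_left, form_smul_right, hmm, hOm,
            hmO, hO.2.1]
          field_simp; ring)
    have hme : form m e ≤ 0 := by
      rw [hm, form_add_left]
      rcases eq_or_ne e u with rfl | heu
      · rw [huu, form_comm v, h]; norm_num
      rcases eq_or_ne e v with rfl | hev
      · rw [hvv, h]; norm_num
      linarith [H.nonpos u hu e he heu.symm, H.nonpos v hv e he hev.symm]
    rw [form_add_left, form_smul_left, form_sub_left, form_smul_left] at hpos
    have h2 := mul_nonpos_of_nonneg_of_nonpos (mul_pos h0 (inv_pos.2 hμ0)).le hme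
    have h3 := mul_pos_of_neg_of_neg (hOS e he) (by linarith : τ - 1 < 0)
    linarith
  -- Meeting hyperplanes: the projection of `O` to their intersection lies in `P` and serves as both
  -- points.
  · obtain ⟨a, b, r, hr, hab, hm, h1, h2⟩ := exists_meet hO (H.mem u hu) (H.mem v hv) huu hvv h
      (by linarith)
    obtain ⟨ha, hb⟩ := hab hle (hOS u hu).le (hOS v hv).le
    have hP : r • (O + a • u + b • v) ∈ P := H.mem_iff.2 ⟨hm, fun e he => by
      rcases eq_or_ne e u with rfl | heu
      · exact h1.le
      rcases eq_or_ne e v with rfl | hev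
      · exact h2.le
      simp only [form_smul_left, form_add_left]
      have h3 := mul_nonpos_of_nonneg_of_nonpos ha (H.nonpos u hu e he heu.symm)
      have h4 := mul_nonpos_of_nonneg_of_nonpos hb (H.nonpos v hv e he hev.symm)
      exact mul_nonpos_of_nonneg_of_nonpos hr.le (by linarith [hOS e he])⟩
    refine ⟨_, hcut hP h1, _, hcut hP h2, ?_⟩
    rw [hm.2.1]
    linarith

lemma exists_card_le_active (H : IsCoxeterPresentation W P S) (hc : IsCompact P) (k : ℕ)
    (hk : k + 1 ≤ Module.finrank ℝ W) : ∃ x ∈ P, k ≤ (active S x).card := by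
  induction k with
  | zero =>
    obtain ⟨O, hO, -⟩ := H.interior_mem
    exact ⟨O, hO, Nat.zero_le _⟩
  | succ k ih =>
    obtain ⟨x, hx, h⟩ := ih (by omega)
    rcases h.eq_or_lt with h | h
    · obtain ⟨y, hy, hlt⟩ := H.exists_active_ssubset hc hx (by omega)
      exact ⟨y, hy, by have := Finset.card_lt_card hlt; omega⟩
    · exact ⟨x, hx, h⟩

/-- An outermost edge of a compact Coxeter polytope of dimension three has small width. -/
lemma exists_narrow_edge (H : IsCoxeterPresentation W P S) (hc : IsCompact P)
    (hW : Module.finrank ℝ W = 4) :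
    ∃ x ∈ P, ∃ V₁ V₂ e₁ e₂, IsEdge P S (active S x) V₁ V₂ e₁ e₂ ∧
      Module.finrank ℝ (Submodule.span ℝ (cut P (active S x))) = 2 ∧
      ∃ p ∈ cut P {e₁}, ∃ q ∈ cut P {e₂}, -form p q < 5.75 := by
  classical
  obtain ⟨O, hO, hOS⟩ := H.interior
  -- Only pairs of facets meeting in `P` compete; at an endpoint of the chosen edge, both other
  -- pairs of facets belong to `T`.
  let T := (S ×ˢ S).filter fun p =>
    p.1 ≠ p.2 ∧ ∃ x ∈ P, p.1 ∈ active S x ∧ p.2 ∈ active S x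
  have hT : ∀ {x u v}, x ∈ P → u ∈ active S x → v ∈ active S x → u ≠ v → (u, v) ∈ T := by
    intro x u v hx hu hv huv
    exact Finset.mem_filter.2 ⟨Finset.mem_product.2 ⟨(mem_active.1 hu).1, (mem_active.1 hv).1⟩,
      huv, x, hx, hu, hv⟩
  have hne : T.Nonempty := by
    obtain ⟨x, hx, h2⟩ := H.exists_card_le_active hc 2 (by omega)
    obtain ⟨u, hu, v, hv, huv⟩ := Finset.one_lt_card.1 h2
    exact ⟨_, hT hx hu hv huv⟩
  obtain ⟨⟨u₁, u₂⟩, hmem, hmax⟩ := T.exists_max_image (fun p => sinhSqDist O p.1 p.2) hne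
  obtain ⟨hS12, h12, x₀, hx₀, hu₁, hu₂⟩ := Finset.mem_filter.1 hmem
  dsimp only at h12 hu₁ hu₂ hmax
  obtain ⟨hS1, hS2⟩ := Finset.mem_product.1 hS12
  dsimp only at hS1 hS2
  have hcos : ∀ {x u v}, x ∈ P → u ∈ active S x → v ∈ active S x → u ≠ v →
      IsCoxeterCosine (-form u v) := by
    intro x u v hx hu hv huv
    obtain ⟨k, hk, h⟩ := H.angle u (mem_active.1 hu).1 v (mem_active.1 hv).1 huv
      ⟨x, (H.mem_iff.1 hx).1, (mem_active.1 hu).2, (mem_active.1 hv).2⟩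
    rw [h, neg_neg]
    exact isCoxeterCosine hk
  obtain ⟨x, hx, hxA⟩ := H.exists_active_eq hx₀ (K := {u₁, u₂}) (by
    intro e he
    rcases Finset.mem_insert.1 he with rfl | he
    · exact hu₁
    · rw [Finset.mem_singleton.1 he]; exact hu₂)
  have hcard : (active S x).card = 2 := by rw [hxA]; exact Finset.card_pair h12
  obtain ⟨V₁, V₂, u₃, u₄, hE⟩ := H.exists_isEdge hc hx rfl (by omega)
  refine ⟨x, hx, V₁, V₂, u₃, u₄, hE, ?_, ?_⟩
  · rw [H.span_cut hx]
    have := (H.finrank_perp_active hx).1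
    omega
  have hproj : ∀ {V₁ V₂ u₃ u₄}, IsEdge P S (active S x) V₁ V₂ u₃ u₄ →
      ∃ α β : ℝ, 0 ≤ α ∧ 0 ≤ β ∧ form (u₃ + α • u₁ + β • u₂) u₁ = 0 ∧
        form (u₃ + α • u₁ + β • u₂) u₂ = 0 ∧
        form (u₃ + α • u₁ + β • u₂) u₃ / 2 * sinhSqDist O u₁ u₂ +
          form O (u₃ + α • u₁ + β • u₂) ^ 2 ≤ 2.87 * sinhSqDist O u₁ u₂ := by
    intro V₁ V₂ u₃ u₄ h
    have hact := h.active_left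
    have hn3 := h.notMem_left
    rw [hxA] at hact hn3
    have m1 : u₁ ∈ active S V₁ := by rw [hact]; simp
    have m2 : u₂ ∈ active S V₁ := by rw [hact]; simp
    have m3 : u₃ ∈ active S V₁ := by rw [hact]; simp
    have h13 : u₁ ≠ u₃ := by rintro rfl; simp at hn3
    have h23 : u₂ ≠ u₃ := by rintro rfl; simp at hn3
    have hS3 := (mem_active.1 m3).1
    exact exists_projection (V := V₁) (H.timelike h.mem_left) (H.unit _ hS1) (H.unit _ hS2) (H.unit _ hS3)
      (mem_active.1 m1).2 (mem_active.1 m2).2 (mem_active.1 m3).2 (hOS _ hS1) (hOS _ hS2)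
      (hOS _ hS3) (hcos h.mem_left m1 m2 h12) (hcos h.mem_left m1 m3 h13)
      (hcos h.mem_left m2 m3 h23) (hmax (u₁, u₃) (hT h.mem_left m1 m3 h13))
      (hmax (u₂, u₃) (hT h.mem_left m2 m3 h23))
  have hS3 := hE.left_mem_normals.1
  have hS4 := hE.swap.left_mem_normals.1
  have hn4 := hE.notMem_right
  rw [hxA] at hn4
  obtain ⟨α, β, hα, hβ, a1, a2, a3⟩ := hproj hE
  obtain ⟨α', β', -, -, b1, b2, b3⟩ := hproj hE.swap
  have ht : -form u₃ u₄ < 5.75 := neg_form_framing_lt hO.2 (H.unit _ hS1) (H.unit _ hS2) (hOS _ hS1) (hOS _ hS2)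
    (hcos hx₀ hu₁ hu₂ h12) (H.nonpos _ hS1 _ hS4 (by rintro rfl; simp at hn4))
    (H.nonpos _ hS2 _ hS4 (by rintro rfl; simp at hn4)) hα hβ a1 a2 a3 b1 b2 b3
  exact H.exists_near_points hc hS3 hS4 hE.ne (by norm_num) ht

/-- At a vertex of an edge, the framing facet of a face lies in the framing facet of the
polytope. -/
lemma cut_framing_subset (H : IsCoxeterPresentation W P S) {W' : Submodule ℝ (Minkowski n)}
    {Q : Set (Minkowski n)} {S' : Finset (Minkowski n)} (H' : IsCoxeterPresentation W' Q S')
    (hQ : IsFace P Q) {x V₁ V₂ u₁ u₂ V₂' e₁ e₂ : Minkowski n} (hx : x ∈ Q)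
    (hE' : IsEdge Q S' (active S' x) V₁ V₂ u₁ u₂)
    (hE : IsEdge P S (active S x) V₁ V₂' e₁ e₂) : cut Q {u₁} ⊆ cut P {e₁} := by
  have hQP : ∀ {z}, z ∈ Q → z ∈ P := fun {z} hz => by
    obtain ⟨-, g, -, hg⟩ := hQ
    rw [hg] at hz
    exact hz.1
  obtain ⟨hu, hV⟩ := hE'.left_mem_normals
  -- For `y` in the relative interior of the facet of `Q`, the smallest face of `P` containing `y`
  -- is this facet, so it suffices that `e₁` is active at `y`.
  obtain ⟨y, hy, hyu⟩ := H'.facet_point u₁ hu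
  have hcut := H.cut_active_eq H'.toIsPresentation hQ hy
  rw [hyu] at hcut
  have hVc : V₁ ∈ cut P (active S y) := by
    rw [hcut]
    exact ⟨hE'.mem_left, fun f hf => by rw [Finset.mem_singleton.1 hf]; exact hV⟩
  have hsub : active S y ⊆ insert e₁ (active S x) := by
    intro f hf
    rw [← hE.active_left]
    exact mem_active.2 ⟨(mem_active.1 hf).1, hVc.2 f hf⟩
  have he : e₁ ∈ active S y := by
    -- Otherwise only normals active at `x` are active at `y`, which puts `x` in the facet of `u₁`.
    by_contra hne
    have hxc : x ∈ cut P (active S y) := ⟨hQP hx, fun f hf => by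
      rcases Finset.mem_insert.1 (hsub hf) with rfl | h
      · exact absurd hf hne
      · exact (mem_active.1 h).2⟩
    rw [hcut] at hxc
    exact hE'.notMem_left (mem_active.2 ⟨hu, hxc.2 u₁ (Finset.mem_singleton_self _)⟩)
  rw [← hcut]
  exact fun z hz => ⟨hz.1, fun f hf => by rw [Finset.mem_singleton.1 hf]; exact hz.2 e₁ he⟩

end IsCoxeterPresentation

lemma IsFace.isCompact {P F : Set (Minkowski n)} (hF : IsFace P F) (hP : IsCompact P) :
    IsCompact F := by
  obtain ⟨-, e, -, rfl⟩ := hF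
  exact hP.inter_right (isClosed_eq (continuous_form continuous_id continuous_const)
    continuous_const)

end HypGeom

theorem mainTheorem4 (n : ℕ) (hn : 4 ≤ n) (P : Set (HypGeom.Minkowski n))
    (hP : HypGeom.IsCoxeterPolytope ⊤ P) (hcompact : IsCompact P)
    (P' : Set (HypGeom.Minkowski n)) (hface : HypGeom.IsFace P P') (hdim : HypGeom.HasDim P' 3)
    (hP' : HypGeom.IsCoxeterPolytope (Submodule.span ℝ P') P') :
    ∃ (E : Set (HypGeom.Minkowski n)) (F : Fin (n - 1) → Set (HypGeom.Minkowski n))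
      (G : Fin 2 → Set (HypGeom.Minkowski n)),
      HypGeom.IsRidge P E F G ∧ HypGeom.width G < 5.75 := by
  obtain ⟨S, H⟩ := hP.exists_presentation
  obtain ⟨S', H'⟩ := hP'.exists_presentation
  obtain ⟨x, hx, V₁, V₂, u₁, u₂, hE', hrank, p, hp, q, hq, hpq⟩ :=
    H'.exists_narrow_edge (hface.isCompact hcompact) hdim
  have hxP : x ∈ P := by
    obtain ⟨-, g, -, hg⟩ := hface
    rw [hg] at hx
    exact hx.1
  have hcut := H.cut_active_eq H'.toIsPresentation hface hx
  have hcard : (HypGeom.active S x).card + 2 = n + 1 := by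
    rw [← hcut, H.span_cut hxP] at hrank
    have := (H.finrank_perp_active hxP).1
    rw [finrank_top, Module.finrank_fintype_fun_eq_card, Fintype.card_fin] at this
    omega
  -- The edge is the same set in P and P', so its vertices agree up to order.
  obtain ⟨e₁, e₂, hE⟩ : ∃ e₁ e₂, HypGeom.IsEdge P S (HypGeom.active S x) V₁ V₂ e₁ e₂ := by
    obtain ⟨A₁, A₂, e₁, e₂, hE⟩ := H.exists_isEdge hcompact hxP rfl (by
      rw [hcard, finrank_top, Module.finrank_fintype_fun_eq_card, Fintype.card_fin])
    have h1 := hE'.vertex_left H'.toIsPresentation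
    have h2 := hE'.swap.vertex_left H'.toIsPresentation
    have hne := hE'.left_ne_right
    rw [← hcut] at h1 h2
    rcases hE.vertex_eq H.toIsPresentation h1 with rfl | rfl <;>
      rcases hE.vertex_eq H.toIsPresentation h2 with rfl | rfl
    · exact absurd rfl hne
    · exact ⟨_, _, hE⟩
    · exact ⟨_, _, hE.swap⟩
    · exact absurd rfl hne
  obtain ⟨F, hF⟩ := hE.exists_isRidge H hxP rfl (by omega) (by omega)
  refine ⟨_, F, _, hF, lt_of_le_of_lt (HypGeom.width_le (fun z hz => H.mem_space hz.1)
    (fun z hz => H.mem_space hz.1) (H.cut_framing_subset H' hface hx hE' hE hp)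
    (H.cut_framing_subset H' hface hx hE'.swap hE.swap hq)) hpq⟩
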